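/- Let $\chi,\Delta_0\in\mathbb{R}$ with $\chi\neq 0$, let $r\in\mathbb{N}$ and $N=r+1$, and let $a,a^\dagger$ be the annihilation and creation operators of a bosonic mode with Fock states $|0\rangle,|1\rangle,\dots$. For $\alpha\in\mathbb{C}$ consider the drive Hamiltonian $$H_{\rm dr}(\alpha)=\tfrac{\chi}{2}a^{\dagger 2}a^2+\Delta_0\,a^\dagger a+\bigl[\chi\alpha\,a^\dagger(a^\dagger a-r)+\text{h.c.}\bigr],$$ and let $\Pi_r=\sum_{n=0}^r|n\rangle\langle n|$ be the projection onto the $N$-dimensional blockade subspace. Put $$H_{d,0}=\sum_{k=0}^{r}E_k|k\rangle\langle k|,\quad E_k=\tfrac{\chi}{2}(k^2-k)+\Delta_0k,$$ $$H_{c,R}=\sum_{k=0}^{r-1}d_k\bigl(|k+1\rangle\langle k|+|k\rangle\langle k+1|\bigr),\quad H_{c,I}=\sum_{k=0}^{r-1}i\,d_k\bigl(|k+1\rangle\langle k|-|k\rangle\langle k+1|\bigr),\quad d_k=(k-r)\sqrt{k+1}.$$ For a control system $H(t)=H_d+\sum_jv_j(t)H_{c,j}$ on $\mathbb{C}^N$,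 its dynamical Lie group is the group generated by the exponentials of the elements of the real Lie algebra generated by $iH_d$ and all $iH_{c,j}$. Assume $r\neq 1-2\Delta_0/\chi$. Then: 1. $\Pi_rH_{\rm dr}(\alpha)\Pi_r=H_{d,0}+\chi\,\mathrm{Re}(\alpha)\,H_{c,R}+\chi\,\mathrm{Im}(\alpha)\,H_{c,I}$ for every $\alpha\in\mathbb{C}$. 2. The dynamical Lie group of the system with drift $H_{d,0}$ and the single control $H_{c,R}$ (that is, with $\mathrm{Im}\,\alpha(t)=0$ for all $t$) contains $SU(N)$, and it equals $U(N)$ if $\mathrm{Tr}\,H_{d,0}\neq0$. The same holds for the system with the two controls $H_{c,R}$ and $H_{c,I}$. 3. Every $V\in SU(N)$, and every $V\in U(N)$ if $\mathrm{Tr}\,H_{d,0}\neq 0$, can be realized exactly with $\mathrm{Im}\,\alpha(t)=0$ for all $t$: there are a time $T>0$ and a bounded measurable real-valued $\alpha(t)$ such that $$V=\mathcal{T}\exp\Bigl[-i\int_0^T\Pi_rH_{\rm dr}(\alpha(t))\Pi_r\,dt\Bigr].$$ -/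

import Mathlib

noncomputable section

namespace KerrControl

attribute [local instance 100] LieRing.ofAssociativeRing

/-! ### The bosonic mode

Operators act on the span of the Fock states `|0⟩, |1⟩, …`, where `|n⟩` is `Finsupp.single n 1`. -/

/-- The annihilation operator: `a |n⟩ = √n |n - 1⟩` (so `a |0⟩ = 0`). -/
def annihilation : Module.End ℂ (ℕ →₀ ℂ) :=
  Finsupp.lsum ℂ fun n => (Real.sqrt n : ℂ) • Finsupp.lsingle (n - 1)

/-- The creation operator: `a† |n⟩ = √(n + 1) |n + 1⟩`. -/
def creation : Module.End ℂ (ℕ →₀ ℂ) :=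
  Finsupp.lsum ℂ fun n => (Real.sqrt (n + 1) : ℂ) • Finsupp.lsingle (n + 1)

/-- The number operator `a† a`. -/
def number : Module.End ℂ (ℕ →₀ ℂ) := creation * annihilation

/-- The drive Hamiltonian
`H_dr = (χ/2) a†² a² + Δ₀ a† a + (χ α a† (a† a - r) + h.c.)` for a displacement `α`. -/
def driveHamiltonian (χ Δ₀ : ℝ) (r : ℕ) (α : ℂ) : Module.End ℂ (ℕ →₀ ℂ) :=
  ((χ / 2 : ℝ) : ℂ) • (creation ^ 2 * annihilation ^ 2) + (Δ₀ : ℂ) • number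
    + ((χ : ℂ) * α) • (creation * (number - (r : ℂ) • 1))
    + ((χ : ℂ) * star α) • ((number - (r : ℂ) • 1) * annihilation)

/-- The compression `Π_r H Π_r` of an operator to the blockade subspace spanned by
`|0⟩, …, |r⟩`, as the matrix with entries `⟨m| H |n⟩`. -/
def blockade (r : ℕ) (H : Module.End ℂ (ℕ →₀ ℂ)) : Matrix (Fin (r + 1)) (Fin (r + 1)) ℂ :=
  Matrix.of fun m n => H (Finsupp.single (n : ℕ) 1) (m : ℕ)

/-- The drift part `∑ E_k |k⟩⟨k|` with `E_k = χ (k² - k) / 2 + Δ₀ k`. -/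
def drift (χ Δ₀ : ℝ) (r : ℕ) : Matrix (Fin (r + 1)) (Fin (r + 1)) ℂ :=
  Matrix.diagonal fun k => ((χ * (((k : ℕ) : ℝ) ^ 2 - ((k : ℕ) : ℝ)) / 2 + Δ₀ * ((k : ℕ) : ℝ) : ℝ) : ℂ)

/-- The couplings `d_k = (k - r) √(k + 1)`, `0 ≤ k < r`. -/
def coupling (r : ℕ) (k : Fin r) : ℝ := (((k : ℕ) : ℝ) - r) * Real.sqrt ((k : ℕ) + 1)

/-- The control part `H_{c,R} = ∑ d_k (|k+1⟩⟨k| + |k⟩⟨k+1|)`. -/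
def controlRe (r : ℕ) : Matrix (Fin (r + 1)) (Fin (r + 1)) ℂ :=
  ∑ k : Fin r, (coupling r k : ℂ) •
    (Matrix.single k.succ k.castSucc 1 + Matrix.single k.castSucc k.succ 1)

/-- The control part `H_{c,I} = ∑ i d_k (|k+1⟩⟨k| - |k⟩⟨k+1|)`. -/
def controlIm (r : ℕ) : Matrix (Fin (r + 1)) (Fin (r + 1)) ℂ :=
  ∑ k : Fin r, (Complex.I * (coupling r k : ℂ)) •
    (Matrix.single k.succ k.castSucc 1 - Matrix.single k.castSucc k.succ 1)

/-! ### Control systems `H(t) = H_d + ∑ j, v_j(t) H_{c,j}` -/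

/-- The dynamical Lie algebra: the real Lie algebra generated by `i H_d` and the `i H_{c,j}`. -/
def dynamicalLieAlgebra {n ι : Type*} [Fintype n] [DecidableEq n]
    (Hd : Matrix n n ℂ) (Hc : ι → Matrix n n ℂ) : LieSubalgebra ℝ (Matrix n n ℂ) :=
  LieSubalgebra.lieSpan ℝ (Matrix n n ℂ)
    (insert (Complex.I • Hd) (Set.range fun j => Complex.I • Hc j))

/-- The dynamical Lie group: the group of matrices generated by the exponentials of the elements
of the dynamical Lie algebra. It is a group because `exp (-X)` is the inverse of `exp X`
(see `exists_inverse_of_mem_dynamicalLieGroup`); it is given as a submonoid of the matrices, like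
`Matrix.unitaryGroup` and `Matrix.specialUnitaryGroup`. -/
def dynamicalLieGroup {n ι : Type*} [Fintype n] [DecidableEq n]
    (Hd : Matrix n n ℂ) (Hc : ι → Matrix n n ℂ) : Submonoid (Matrix n n ℂ) :=
  Submonoid.closure
    {g | ∃ X ∈ dynamicalLieAlgebra Hd Hc, g = NormedSpace.exp X}

theorem exists_inverse_of_mem_dynamicalLieGroup {n ι : Type*} [Fintype n] [DecidableEq n]
    (Hd : Matrix n n ℂ) (Hc : ι → Matrix n n ℂ) {g : Matrix n n ℂ}
    (hg : g ∈ dynamicalLieGroup Hd Hc) :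
    ∃ h ∈ dynamicalLieGroup Hd Hc, g * h = 1 ∧ h * g = 1 := by
  induction hg using Submonoid.closure_induction with
  | mem x hx =>
    obtain ⟨X, hX, rfl⟩ := hx
    refine ⟨NormedSpace.exp (-X),
      Submonoid.subset_closure ⟨-X, neg_mem hX, rfl⟩, ?_, ?_⟩
    · rw [← Matrix.exp_add_of_commute _ _ (Commute.neg_right (Commute.refl X))]; simp
    · rw [← Matrix.exp_add_of_commute _ _ (Commute.neg_left (Commute.refl X))]; simp
  | one => exact ⟨1, one_mem _, by simp⟩
  | mul x y _ _ hx hy =>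
    obtain ⟨a, ha, h1, h2⟩ := hx
    obtain ⟨b, hb, h3, h4⟩ := hy
    refine ⟨b * a, mul_mem hb ha, ?_, ?_⟩
    · rw [mul_assoc, ← mul_assoc y, h3, one_mul, h1]
    · rw [mul_assoc, ← mul_assoc a, h2, one_mul, h4]

/-- `U` is the propagator `U(t) = 𝒯 exp (-i ∫₀ᵗ H(s) ds)` on `[0, T]`: the continuous solution of
`U(t) = 1 - i ∫₀ᵗ H(s) U(s) ds`, for a time-dependent Hamiltonian `H` integrable on `[0, T]`. -/
structure IsPropagator {n : Type*} [Fintype n] [DecidableEq n]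
    (H : ℝ → Matrix n n ℂ) (T : ℝ) (U : ℝ → Matrix n n ℂ) : Prop where
  integrable : ∀ i j, IntervalIntegrable (fun s => H s i j) MeasureTheory.volume 0 T
  continuousOn : ContinuousOn U (Set.Icc 0 T)
  eq : ∀ t ∈ Set.Icc 0 T, ∀ i j,
    U t i j = (1 : Matrix n n ℂ) i j - Complex.I * ∫ s in (0 : ℝ)..t, (H s * U s) i j

/-- The unitary `V` on the blockade subspace is realized as `V = U(T)`, at some time `T > 0`, by the
projected drive Hamiltonian with a bounded measurable `α(t)` satisfying `Im α(t) = 0` for all `t`. -/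
def RealizedByRealDrive (χ Δ₀ : ℝ) (r : ℕ) (V : Matrix (Fin (r + 1)) (Fin (r + 1)) ℂ) : Prop :=
  ∃ T : ℝ, 0 < T ∧ ∃ α : ℝ → ℂ, Measurable α ∧ (∃ C : ℝ, ∀ t, ‖α t‖ ≤ C) ∧
    (∀ t, (α t).im = 0) ∧
    ∃ U : ℝ → Matrix (Fin (r + 1)) (Fin (r + 1)) ℂ,
      IsPropagator (fun t => blockade r (driveHamiltonian χ Δ₀ r (α t))) T U ∧ U T = V

end KerrControl

end

/-!
Let `L` be a Lie algebra containing `i H_d` and `i H_{c,R}`, where the drift has the level gaps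
`z_k = E_{k+1} - E_k = χ k + Δ₀`. The square of `ad (i H_d)` multiplies the `k`-th transition of
`i H_{c,R}` by `-z_k²`, and `z_j² - z_k² = (z_j + z_k) χ (j - k)`. If `r < 1 - 2 Δ₀ / χ`, the sums
`z_j + z_0` with `j < r` never vanish; if `r > 1 - 2 Δ₀ / χ`, the same holds for `z_j + z_{r-1}`. So
a polynomial in `ad (i H_d)²` isolates the first or the last transition from all the others. Once
`L` contains `𝔰𝔲(2)` on the transition `j`, it contains `i (|j+1⟩⟨j+1| - |j⟩⟨j|)`, whose gaps are
the `j`-th row of the Cartan matrix of type `A_r`: bracketing with it only sees the transition `j`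
and its neighbours, and the property spreads along the chain. Hence `𝔰𝔲(N) ≤ L`, and `𝔲(N) ≤ L` if
the drift has nonzero trace.

Only the flows `exp (t X)` with `t ≥ 0` are available to a control. By the inverse function theorem
they generate a semigroup with an interior point in `U(N)`; in a compact group the inverse of that
point is approximated by its powers, so the semigroup contains a neighbourhood of `1`, hence
everything. For `SU(N)` alone, adjoin the scalar generator `i`, and get rid of the scalars by taking
`N`-th powers.
-/

noncomputable section

namespace KerrControl

attribute [local instance 100] LieRing.ofAssociativeRing

section SkewAdjoint

/-- The Lie algebra `𝔲(A)` of the skew-adjoint elements of a real star algebra `A`. -/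
def skewAdjointLie (A : Type*) [Ring A] [StarRing A] [Algebra ℝ A] [StarModule ℝ A] :
    LieSubalgebra ℝ A where
  __ := skewAdjoint.submodule ℝ A
  lie_mem' {x y} hx hy := by
    have hx : star x = -x := hx
    have hy : star y = -y := hy
    change star ⁅x, y⁆ = -⁅x, y⁆
    rw [Ring.lie_def, star_sub, star_mul, star_mul, hx, hy]
    noncomm_ring

variable {n : Type*}

theorem I_smul_mem_skewAdjoint {H : Matrix n n ℂ} (hH : H.IsHermitian) :
    Complex.I • H ∈ skewAdjoint (Matrix n n ℂ) := by
  rw [skewAdjoint.mem_iff, Matrix.star_eq_conjTranspose, Matrix.conjTranspose_smul, hH,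
    Complex.star_def, Complex.conj_I, neg_smul]

variable [Fintype n]

theorem re_trace_eq_zero_of_mem_skewAdjoint {x : Matrix n n ℂ}
    (hx : x ∈ skewAdjoint (Matrix n n ℂ)) : x.trace.re = 0 := by
  have h := congrArg Complex.re (congrArg Matrix.trace (skewAdjoint.mem_iff.1 hx))
  rw [Matrix.star_eq_conjTranspose, Matrix.trace_conjTranspose, Matrix.trace_neg,
    Complex.star_def, Complex.conj_re, Complex.neg_re] at h
  linarith

variable [DecidableEq n]

variable (n) in
/-- The Lie algebra `𝔰𝔲(n)` of the skew-adjoint complex matrices with trace zero. -/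
def specialUnitaryLie : LieSubalgebra ℝ (Matrix n n ℂ) where
  __ := (skewAdjointLie (Matrix n n ℂ)).toSubmodule ⊓
    LinearMap.ker (Matrix.traceLinearMap n ℝ ℂ)
  lie_mem' {x y} hx hy := by
    refine ⟨LieSubalgebra.lie_mem _ hx.1 hy.1, ?_⟩
    change (x * y - y * x).trace = 0
    rw [Matrix.trace_sub, Matrix.trace_mul_comm, sub_self]

theorem mem_specialUnitaryLie {x : Matrix n n ℂ} :
    x ∈ specialUnitaryLie n ↔ x ∈ skewAdjoint (Matrix n n ℂ) ∧ x.trace = 0 :=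
  Iff.rfl

theorem skewAdjointLie_le_of_specialUnitaryLie_le {L : LieSubalgebra ℝ (Matrix n n ℂ)}
    (hL : specialUnitaryLie n ≤ L) {y : Matrix n n ℂ} (hy : y ∈ L)
    (hys : y ∈ skewAdjoint (Matrix n n ℂ)) (hy0 : y.trace ≠ 0) :
    skewAdjointLie (Matrix n n ℂ) ≤ L := by
  intro x hx
  have hyim : y.trace.im ≠ 0 := fun h =>
    hy0 (Complex.ext (re_trace_eq_zero_of_mem_skewAdjoint hys) h)
  set c : ℝ := x.trace.im / y.trace.im with hc
  have htrace : (x - c • y).trace = 0 := by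
    apply Complex.ext <;>
      simp [Matrix.trace_sub, Matrix.trace_smul, re_trace_eq_zero_of_mem_skewAdjoint hx,
        re_trace_eq_zero_of_mem_skewAdjoint hys, hc, hyim]
  have hmem : x - c • y ∈ L :=
    hL (mem_specialUnitaryLie.2 ⟨sub_mem hx (skewAdjoint.smul_mem c hys), htrace⟩)
  simpa using add_mem hmem (L.smul_mem c hy)

end SkewAdjoint

section SkewSingle

variable {n : Type*} [DecidableEq n]

/-- The skew-adjoint matrices `c |i⟩⟨j| - c̄ |j⟩⟨i|`, as a real-linear function of `c`. -/
def skewSingle (i j : n) : ℂ →ₗ[ℝ] Matrix n n ℂ :=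
  Matrix.singleLinearMap ℝ i j - Matrix.singleLinearMap ℝ j i ∘ₗ Complex.conjAe.toLinearMap

theorem skewSingle_apply (i j : n) (c : ℂ) :
    skewSingle i j c = Matrix.single i j c - Matrix.single j i (star c) :=
  rfl

theorem skewSingle_swap (i j : n) (c : ℂ) : skewSingle j i c = -skewSingle i j (star c) := by
  simp [skewSingle_apply]

theorem skewSingle_mem_skewAdjoint (i j : n) (c : ℂ) :
    skewSingle i j c ∈ skewAdjoint (Matrix n n ℂ) := by
  simp [skewAdjoint.mem_iff, skewSingle_apply, Matrix.star_eq_conjTranspose]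

variable [Fintype n]

theorem skewSingle_mem_specialUnitaryLie {i j : n} (hij : i ≠ j) (c : ℂ) :
    skewSingle i j c ∈ specialUnitaryLie n :=
  mem_specialUnitaryLie.2 ⟨skewSingle_mem_skewAdjoint i j c, by
    simp [skewSingle_apply, Matrix.trace_single_eq_of_ne _ _ _ hij,
      Matrix.trace_single_eq_of_ne _ _ _ hij.symm]⟩

theorem lie_skewSingle_of_ne {i j k : n} (hij : i ≠ j) (hjk : j ≠ k) (hik : i ≠ k) (a b : ℂ) :
    ⁅skewSingle i j a, skewSingle j k b⁆ = skewSingle i k (a * b) := by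
  simp only [Ring.lie_def, skewSingle_apply, sub_mul, mul_sub, Matrix.single_mul_single_same,
    Matrix.single_mul_single_of_ne _ _ _ _ hij, Matrix.single_mul_single_of_ne _ _ _ _ hij.symm,
    Matrix.single_mul_single_of_ne _ _ _ _ hjk, Matrix.single_mul_single_of_ne _ _ _ _ hjk.symm,
    Matrix.single_mul_single_of_ne _ _ _ _ hik, Matrix.single_mul_single_of_ne _ _ _ _ hik.symm,
    star_mul]
  abel

theorem lie_skewSingle_self {i j : n} (hij : i ≠ j) (a b : ℂ) :
    ⁅skewSingle i j a, skewSingle i j b⁆ =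
      skewSingle i i (star a * b) - skewSingle j j (star a * b) := by
  simp only [Ring.lie_def, skewSingle_apply, sub_mul, mul_sub, Matrix.single_mul_single_same,
    Matrix.single_mul_single_of_ne _ _ _ _ hij, Matrix.single_mul_single_of_ne _ _ _ _ hij.symm,
    star_mul, star_star, mul_comm]
  abel

theorem lie_diagonal_single {R : Type*} [CommRing R] (z : n → R) (i j : n) (c : R) :
    ⁅Matrix.diagonal z, Matrix.single i j c⁆ = Matrix.single i j ((z i - z j) * c) := by
  ext k l
  rw [Ring.lie_def, Matrix.sub_apply, Matrix.diagonal_mul, Matrix.mul_diagonal,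
    Matrix.single_apply, Matrix.single_apply]
  split_ifs with h
  · rw [h.1, h.2]
    ring
  · simp

theorem lie_diagonal_skewSingle (z : n → ℝ) (i j : n) (c : ℂ) :
    ⁅Matrix.diagonal fun k => Complex.I * (z k : ℂ), skewSingle i j c⁆ =
      skewSingle i j (Complex.I * ((z i - z j : ℝ) : ℂ) * c) := by
  rw [skewSingle_apply, lie_sub, lie_diagonal_single, lie_diagonal_single, skewSingle_apply]
  congr 2
  · push_cast
    ring
  · simp only [star_mul', Complex.star_def, Complex.conj_I, Complex.conj_ofReal]
    push_cast
    ring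

/-- `L` contains every matrix `c |i⟩⟨j| - c̄ |j⟩⟨i|`; vacuous for `i = j`, which makes it an
equivalence relation. -/
def Linked (L : LieSubalgebra ℝ (Matrix n n ℂ)) (i j : n) : Prop :=
  i ≠ j → ∀ c, skewSingle i j c ∈ L

variable {L : LieSubalgebra ℝ (Matrix n n ℂ)} {i j k : n}

theorem Linked.symm (h : Linked L i j) : Linked L j i := fun hji c => by
  rw [skewSingle_swap]
  exact neg_mem (h hji.symm _)

theorem Linked.trans (hij : Linked L i j) (hjk : Linked L j k) : Linked L i k := fun hik c => by
  rcases eq_or_ne i j with rfl | hne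
  · exact hjk hik c
  rcases eq_or_ne j k with rfl | hne'
  · exact hij hik c
  have h := L.lie_mem (hij hne c) (hjk hne' 1)
  rwa [lie_skewSingle_of_ne hne hne' hik, mul_one] at h

theorem Linked.skewSingle_self_sub_mem (h : Linked L i j) (c : ℂ) :
    skewSingle i i c - skewSingle j j c ∈ L := by
  rcases eq_or_ne i j with rfl | hij
  · simp
  have h' := L.lie_mem (h hij 1) (h hij c)
  rwa [lie_skewSingle_self hij, star_one, one_mul] at h'

theorem two_smul_eq_sum_skewSingle {x : Matrix n n ℂ} (hx : x ∈ skewAdjoint (Matrix n n ℂ)) :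
    (2 : ℝ) • x = ∑ i, ∑ j, skewSingle i j (x i j) := by
  have hsum : ∑ i, ∑ j, skewSingle i j (x i j) = x - star x := by
    simp only [skewSingle_apply, Finset.sum_sub_distrib]
    rw [Finset.sum_comm (f := fun i j => Matrix.single j i (star (x i j)))]
    congr 1
    · exact (Matrix.matrix_eq_sum_single x).symm
    · exact (Matrix.matrix_eq_sum_single (star x)).symm
  rw [hsum, skewAdjoint.mem_iff.1 hx, sub_neg_eq_add, two_smul]

theorem specialUnitaryLie_le_of_linked (hL : ∀ i j, Linked L i j) : specialUnitaryLie n ≤ L := by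
  intro x hx
  obtain ⟨hx, htr⟩ := mem_specialUnitaryLie.1 hx
  suffices h : (2 : ℝ) • x ∈ L from (L.toSubmodule.smul_mem_iff two_ne_zero).1 h
  rcases isEmpty_or_nonempty n with _ | ⟨⟨o⟩⟩
  · simp [Subsingleton.elim x 0]
  have hzero : ∑ i, skewSingle o o (x i i) = 0 := by
    rw [← map_sum]
    exact (congrArg _ htr).trans (map_zero _)
  -- The trace condition lets us move every diagonal term to the index `o` at no cost.
  have key : (2 : ℝ) • x = ∑ i, ∑ j,
      (skewSingle i j (x i j) - if j = i then skewSingle o o (x i i) else 0) := by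
    simp [two_smul_eq_sum_skewSingle hx, hzero]
  rw [key]
  refine sum_mem fun i _ => sum_mem fun j _ => ?_
  split_ifs with hij
  · subst hij
    exact (hL j o).skewSingle_self_sub_mem _
  · rw [sub_zero]
    exact hL i j (Ne.symm hij) _

end SkewSingle

theorem mem_of_sum_eigenvectors_mem {K V ι : Type*} [Field K] [AddCommGroup V] [Module K V]
    [Fintype ι] {p : Submodule K V} {f : Module.End K V} (hf : ∀ x ∈ p, f x ∈ p) {v : ι → V}
    {μ : ι → K} (hv : ∀ k, f (v k) = μ k • v k) (hsum : ∑ k, v k ∈ p) {k₀ : ι}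
    (hμ : ∀ j ≠ k₀, μ j ≠ μ k₀) : v k₀ ∈ p := by
  classical
  have key : ∀ s : Finset ι, ∑ k, (∏ j ∈ s, (μ k - μ j)) • v k ∈ p := fun s => by
    induction s using Finset.induction_on with
    | empty => simpa using hsum
    | insert a s ha ih =>
      convert p.sub_mem (hf _ ih) (p.smul_mem (μ a) ih) using 1
      rw [map_sum, Finset.smul_sum, ← Finset.sum_sub_distrib]
      refine Finset.sum_congr rfl fun k _ => ?_
      rw [map_smul, hv, Finset.prod_insert ha]
      module
  have h := key (Finset.univ.erase k₀)
  rw [Finset.sum_eq_single k₀ (fun k _ hk => by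
    rw [Finset.prod_eq_zero (Finset.mem_erase.2 ⟨hk, Finset.mem_univ k⟩) (sub_self _), zero_smul])
    (by simp)] at h
  refine (p.smul_mem_iff (Finset.prod_ne_zero_iff.2 fun j hj => ?_)).1 h
  exact sub_ne_zero.2 (hμ j (Finset.ne_of_mem_erase hj)).symm

theorem linked_of_skewSingle_mem {n : Type*} [Fintype n] [DecidableEq n]
    {L : LieSubalgebra ℝ (Matrix n n ℂ)} {z : n → ℝ}
    (hz : (Matrix.diagonal fun k => Complex.I * (z k : ℂ)) ∈ L) {i j : n} (hij : z i - z j ≠ 0)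
    {c : ℂ} (hc : c ≠ 0) (hmem : skewSingle i j c ∈ L) : Linked L i j := by
  intro _ b
  have hbracket := L.lie_mem hz hmem
  rw [lie_diagonal_skewSingle] at hbracket
  have hb : b = (b / c).re • c
      + ((b / c).im / (z i - z j)) • (Complex.I * ((z i - z j : ℝ) : ℂ) * c) := by
    have hij' : ((z i - z j : ℝ) : ℂ) ≠ 0 := Complex.ofReal_ne_zero.2 hij
    calc b = (((b / c).re : ℂ) + ((b / c).im : ℂ) * Complex.I) * c := by
          rw [Complex.re_add_im, div_mul_cancel₀ _ hc]
      _ = _ := by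
          rw [Complex.real_smul, Complex.real_smul, Complex.ofReal_div]
          field_simp
  rw [hb, map_add, map_smul, map_smul]
  exact add_mem (L.smul_mem _ hmem) (L.smul_mem _ hbracket)

section Hopping

variable {r : ℕ}

/-- The skew-adjoint tridiagonal matrix `∑ k, c_k |k+1⟩⟨k| - c̄_k |k⟩⟨k+1|`. -/
def hopping (c : Fin r → ℂ) : Matrix (Fin (r + 1)) (Fin (r + 1)) ℂ :=
  ∑ k : Fin r, skewSingle k.succ k.castSucc (c k)

theorem hopping_mem_specialUnitaryLie (c : Fin r → ℂ) :
    hopping c ∈ specialUnitaryLie (Fin (r + 1)) :=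
  sum_mem fun k _ => skewSingle_mem_specialUnitaryLie k.castSucc_lt_succ.ne' _

variable {L : LieSubalgebra ℝ (Matrix (Fin (r + 1)) (Fin (r + 1)) ℂ)}

theorem linked_of_linked_succ (h : ∀ k : Fin r, Linked L k.succ k.castSucc) (i j : Fin (r + 1)) :
    Linked L i j := by
  have linked_zero : ∀ i, Linked L i 0 :=
    Fin.induction (fun h => absurd rfl h) fun k ih => (h k).trans ih
  exact (linked_zero i).trans (linked_zero j).symm

variable {z : Fin (r + 1) → ℝ} {c : Fin r → ℂ} {k₀ : Fin r}

theorem linked_of_isolated_gap (hz : (Matrix.diagonal fun k => Complex.I * (z k : ℂ)) ∈ L)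
    (hc : hopping c ∈ L) (hck : c k₀ ≠ 0) (hgap : z k₀.succ - z k₀.castSucc ≠ 0)
    (hiso : ∀ j ≠ k₀, (z j.succ - z j.castSucc) ^ 2 ≠ (z k₀.succ - z k₀.castSucc) ^ 2) :
    Linked L k₀.succ k₀.castSucc := by
  set D : Matrix (Fin (r + 1)) (Fin (r + 1)) ℂ := Matrix.diagonal fun k => Complex.I * (z k : ℂ)
  refine linked_of_skewSingle_mem hz hgap hck
    (mem_of_sum_eigenvectors_mem (p := L.toSubmodule) (f := LieAlgebra.ad ℝ _ D ^ 2)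
      (v := fun k : Fin r => skewSingle k.succ k.castSucc (c k))
      (μ := fun k => -(z k.succ - z k.castSucc) ^ 2)
      (fun x hx => L.lie_mem hz (L.lie_mem hz hx)) (fun k => ?_) hc
      fun j hj => neg_injective.ne (hiso j hj))
  change ⁅D, ⁅D, skewSingle k.succ k.castSucc (c k)⁆⁆ = _
  rw [lie_diagonal_skewSingle, lie_diagonal_skewSingle, ← map_smul, Complex.real_smul]
  congr 1
  push_cast
  linear_combination (z k.succ - z k.castSucc : ℂ) ^ 2 * c k * Complex.I_sq

theorem linked_of_linked_of_gap_ne_zero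
    (hz : (Matrix.diagonal fun k => Complex.I * (z k : ℂ)) ∈ L) (hc : hopping c ∈ L)
    (hck : c k₀ ≠ 0) (hgap : z k₀.succ - z k₀.castSucc ≠ 0)
    (hother : ∀ l ≠ k₀, z l.succ - z l.castSucc ≠ 0 → Linked L l.succ l.castSucc) :
    Linked L k₀.succ k₀.castSucc := by
  have hsum := L.lie_mem hz hc
  rw [hopping, lie_sum, ← Finset.add_sum_erase _ _ (Finset.mem_univ k₀)] at hsum
  simp only [lie_diagonal_skewSingle] at hsum
  have hrest : ∑ l ∈ Finset.univ.erase k₀, skewSingle l.succ l.castSucc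
      (Complex.I * ((z l.succ - z l.castSucc : ℝ) : ℂ) * c l) ∈ L := by
    refine sum_mem fun l hl => ?_
    by_cases h0 : z l.succ - z l.castSucc = 0
    · simp [h0]
    · exact hother l (Finset.ne_of_mem_erase hl) h0 l.castSucc_lt_succ.ne' _
  refine linked_of_skewSingle_mem hz hgap ?_ ((add_mem_cancel_right hrest).1 hsum)
  exact mul_ne_zero (mul_ne_zero Complex.I_ne_zero (Complex.ofReal_ne_zero.2 hgap)) hck

theorem single_succ_sub_single_castSucc_gap (j k : Fin r) :
    (Pi.single j.succ 1 - Pi.single j.castSucc 1 : Fin (r + 1) → ℝ) k.succ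
      - (Pi.single j.succ 1 - Pi.single j.castSucc 1 : Fin (r + 1) → ℝ) k.castSucc =
        CartanMatrix.A r j k := by
  simp only [CartanMatrix.A, Matrix.of_apply, Pi.sub_apply, Pi.single_apply, Fin.ext_iff,
    Fin.val_succ, Fin.val_castSucc]
  split_ifs <;> first | omega | norm_num

theorem Linked.diagonal_mem {n : Type*} [Fintype n] [DecidableEq n]
    {L : LieSubalgebra ℝ (Matrix n n ℂ)} {i j : n} (h : Linked L i j) :
    (Matrix.diagonal fun k =>
      Complex.I * ((Pi.single i 1 - Pi.single j 1 : n → ℝ) k : ℂ)) ∈ L := by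
  have hself : ∀ k : n, skewSingle k k (Complex.I / 2) =
      Matrix.diagonal (Pi.single k Complex.I) := fun k => by
    rw [skewSingle_apply, Matrix.diagonal_single, sub_eq_iff_eq_add, ← Matrix.single_add]
    congr 1
    simp only [star_div₀, Complex.star_def, Complex.conj_I, Complex.conj_ofNat]
    ring
  convert h.skewSingle_self_sub_mem (Complex.I / 2) using 1
  rw [hself, hself, Matrix.diagonal_sub]
  congr 1
  ext k
  simp only [Pi.sub_apply, Pi.single_apply]
  split_ifs <;> simp

theorem cartanMatrix_A_ne_zero_iff {j k : Fin r} : CartanMatrix.A r j k ≠ 0 ↔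
    (j : ℕ) = k ∨ (j : ℕ) + 1 = k ∨ (k : ℕ) + 1 = j := by
  simp only [CartanMatrix.A, Matrix.of_apply, Fin.ext_iff]
  split_ifs <;> omega

theorem linked_of_adjacent (hc : hopping c ∈ L) {j k : Fin r} (hck : c k ≠ 0)
    (hj : Linked L j.succ j.castSucc) (hjk : CartanMatrix.A r j k ≠ 0)
    (hother : ∀ l ≠ k, CartanMatrix.A r j l ≠ 0 → Linked L l.succ l.castSucc) :
    Linked L k.succ k.castSucc := by
  refine linked_of_linked_of_gap_ne_zero hj.diagonal_mem hc hck ?_ fun l hl hgap => hother l hl ?_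
  · rwa [single_succ_sub_single_castSucc_gap, Int.cast_ne_zero]
  · rwa [single_succ_sub_single_castSucc_gap, Int.cast_ne_zero] at hgap

theorem linked_of_linked_first (hc : hopping c ∈ L) (hc0 : ∀ k, c k ≠ 0)
    (hfirst : ∀ k : Fin r, (k : ℕ) = 0 → Linked L k.succ k.castSucc) (k : Fin r) :
    Linked L k.succ k.castSucc := by
  induction k using WellFoundedLT.induction with
  | ind k ih =>
    rcases Nat.eq_zero_or_pos k with hk | hk
    · exact hfirst k hk
    refine linked_of_adjacent hc (hc0 k) (j := ⟨k - 1, by omega⟩) (ih _ ?_) ?_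
      fun l hl hA => ih l ?_
    · exact Fin.lt_def.2 (by simp only; omega)
    · exact cartanMatrix_A_ne_zero_iff.2 (Or.inr (Or.inl (Nat.sub_add_cancel hk)))
    · have hA := cartanMatrix_A_ne_zero_iff.1 hA
      exact Fin.lt_def.2 (by simp only [ne_eq, Fin.ext_iff] at hl hA ⊢; omega)

theorem linked_of_linked_last (hc : hopping c ∈ L) (hc0 : ∀ k, c k ≠ 0)
    (hlast : ∀ k : Fin r, (k : ℕ) + 1 = r → Linked L k.succ k.castSucc) (k : Fin r) :
    Linked L k.succ k.castSucc := by
  induction k using WellFoundedGT.induction with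
  | ind k ih =>
    by_cases hk : (k : ℕ) + 1 = r
    · exact hlast k hk
    refine linked_of_adjacent hc (hc0 k) (j := ⟨k + 1, by omega⟩) (ih _ ?_) ?_
      fun l hl hA => ih l ?_
    · exact Fin.lt_def.2 (by simp only; omega)
    · exact cartanMatrix_A_ne_zero_iff.2 (Or.inr (Or.inr rfl))
    · have hA := cartanMatrix_A_ne_zero_iff.1 hA
      exact Fin.lt_def.2 (by simp only [ne_eq, Fin.ext_iff] at hl hA ⊢; omega)

end Hopping

section Kerr

/-- The energies `E_k` of the drift. -/
def energy (χ Δ₀ : ℝ) (k : ℕ) : ℝ :=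
  χ * ((k : ℝ) ^ 2 - k) / 2 + Δ₀ * k

theorem energy_succ_sub_energy (χ Δ₀ : ℝ) (k : ℕ) :
    energy χ Δ₀ (k + 1) - energy χ Δ₀ k = χ * k + Δ₀ := by
  simp only [energy, Nat.cast_add, Nat.cast_one]
  ring

variable {r : ℕ}

theorem coupling_ne_zero (k : Fin r) : coupling r k ≠ 0 := by
  have h : ((k : ℕ) : ℝ) < r := by exact_mod_cast k.2
  exact mul_ne_zero (sub_ne_zero.2 h.ne) (Real.sqrt_ne_zero'.2 (by positivity))

theorem I_smul_drift (χ Δ₀ : ℝ) : Complex.I • drift χ Δ₀ r =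
    Matrix.diagonal fun k : Fin (r + 1) => Complex.I * (energy χ Δ₀ k : ℂ) :=
  Matrix.diagonal_smul Complex.I _ |>.symm

theorem I_smul_controlRe :
    Complex.I • controlRe r = hopping fun k => Complex.I * coupling r k := by
  rw [controlRe, hopping, Finset.smul_sum]
  refine Finset.sum_congr rfl fun k _ => ?_
  have hstar : star (Complex.I * (coupling r k : ℂ)) = -(Complex.I * coupling r k) := by
    rw [star_mul', Complex.star_def, Complex.conj_I, Complex.conj_ofReal, neg_mul]
  rw [skewSingle_apply, hstar, ← Matrix.single_neg, sub_neg_eq_add]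
  simp [Matrix.smul_single, smul_add]

theorem I_smul_controlIm : Complex.I • controlIm r = hopping fun k => (-coupling r k : ℂ) := by
  rw [controlIm, hopping, Finset.smul_sum]
  refine Finset.sum_congr rfl fun k _ => ?_
  simp [skewSingle_apply, Matrix.smul_single, smul_sub, ← mul_assoc]

theorem I_smul_controlRe_mem_specialUnitaryLie :
    Complex.I • controlRe r ∈ specialUnitaryLie (Fin (r + 1)) :=
  I_smul_controlRe (r := r) ▸ hopping_mem_specialUnitaryLie _

theorem I_smul_controlIm_mem_specialUnitaryLie :
    Complex.I • controlIm r ∈ specialUnitaryLie (Fin (r + 1)) :=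
  I_smul_controlIm (r := r) ▸ hopping_mem_specialUnitaryLie _

theorem I_smul_drift_mem_skewAdjoint (χ Δ₀ : ℝ) :
    Complex.I • drift χ Δ₀ r ∈ skewAdjoint (Matrix (Fin (r + 1)) (Fin (r + 1)) ℂ) :=
  I_smul_mem_skewAdjoint (Matrix.isHermitian_diagonal_of_self_adjoint _
    (funext fun _ => Complex.conj_ofReal _))

variable {χ Δ₀ : ℝ} {L : LieSubalgebra ℝ (Matrix (Fin (r + 1)) (Fin (r + 1)) ℂ)}

theorem linked_of_add_ne_zero (hχ : χ ≠ 0) (hdrift : Complex.I • drift χ Δ₀ r ∈ L)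
    (hcontrol : Complex.I • controlRe r ∈ L) {k : Fin r}
    (hk : ∀ j : Fin r, ((j : ℕ) : ℝ) + (k : ℕ) + 2 * Δ₀ / χ ≠ 0) :
    Linked L k.succ k.castSucc := by
  rw [I_smul_drift] at hdrift
  rw [I_smul_controlRe] at hcontrol
  have gap_add_gap_ne_zero : ∀ j : Fin r, (χ * (j : ℕ) + Δ₀) + (χ * (k : ℕ) + Δ₀) ≠ 0 :=
    fun j => by
      convert mul_ne_zero hχ (hk j) using 1
      field_simp
      ring
  refine linked_of_isolated_gap hdrift hcontrol
    (mul_ne_zero Complex.I_ne_zero (Complex.ofReal_ne_zero.2 (coupling_ne_zero k)))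
    ?_ fun j hj => ?_
  · rw [Fin.val_succ, Fin.val_castSucc, energy_succ_sub_energy]
    exact fun h => gap_add_gap_ne_zero k (by rw [h, add_zero])
  · simp only [Fin.val_succ, Fin.val_castSucc, energy_succ_sub_energy]
    refine sub_ne_zero.1 ?_
    rw [sq_sub_sq, add_sub_add_right_eq_sub, ← mul_sub]
    refine mul_ne_zero (gap_add_gap_ne_zero j) (mul_ne_zero hχ (sub_ne_zero.2 ?_))
    exact_mod_cast Fin.val_ne_of_ne hj

theorem specialUnitaryLie_le_of_drift_mem (hχ : χ ≠ 0) (hr : (r : ℝ) ≠ 1 - 2 * Δ₀ / χ)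
    (hdrift : Complex.I • drift χ Δ₀ r ∈ L) (hcontrol : Complex.I • controlRe r ∈ L) :
    specialUnitaryLie (Fin (r + 1)) ≤ L := by
  refine specialUnitaryLie_le_of_linked (linked_of_linked_succ ?_)
  have hhop := hcontrol
  rw [I_smul_controlRe] at hhop
  have hne : ∀ k : Fin r, Complex.I * (coupling r k : ℂ) ≠ 0 := fun k =>
    mul_ne_zero Complex.I_ne_zero (Complex.ofReal_ne_zero.2 (coupling_ne_zero k))
  rcases lt_or_gt_of_ne hr with hlt | hgt
  · refine linked_of_linked_first hhop hne fun k hk =>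
      linked_of_add_ne_zero hχ hdrift hcontrol fun j => ne_of_lt ?_
    have hj : ((j : ℕ) : ℝ) + 1 ≤ r := by exact_mod_cast j.2
    rw [hk]
    push_cast
    linarith
  · refine linked_of_linked_last hhop hne fun k hk =>
      linked_of_add_ne_zero hχ hdrift hcontrol fun j => ne_of_gt ?_
    have hk : ((k : ℕ) : ℝ) + 1 = r := by exact_mod_cast hk
    linarith [Nat.cast_nonneg (α := ℝ) (j : ℕ)]

end Kerr

section Reachability

open Filter Topology NormedSpace

section LieSpan

variable {R 𝔤 : Type*} [CommRing R] [LieRing 𝔤] [LieAlgebra R 𝔤]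

theorem lieSpan_le_of_lie_mem {s : Set 𝔤} {W : Submodule R 𝔤} (hs : s ⊆ W)
    (hlie : ∀ x ∈ s, ∀ w ∈ W, ⁅x, w⁆ ∈ W) :
    (LieSubalgebra.lieSpan R 𝔤 s).toSubmodule ≤ W := by
  intro x hx
  suffices h : x ∈ W ∧ ∀ w ∈ W, ⁅x, w⁆ ∈ W from h.1
  induction hx using LieSubalgebra.lieSpan_induction with
  | mem x hx => exact ⟨hs hx, hlie x hx⟩
  | zero => simp
  | add x y _ _ hx hy =>
    exact ⟨add_mem hx.1 hy.1, fun w hw => add_lie x y w ▸ add_mem (hx.2 w hw) (hy.2 w hw)⟩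
  | smul c x _ hx =>
    exact ⟨W.smul_mem c hx.1, fun w hw => smul_lie c x w ▸ W.smul_mem c (hx.2 w hw)⟩
  | lie x y _ _ hx hy =>
    exact ⟨hx.2 y hy.1, fun w hw =>
      lie_lie x y w ▸ sub_mem (hx.2 _ (hy.2 w hw)) (hy.2 _ (hx.2 w hw))⟩

end LieSpan

section FlowSemigroup

variable {A : Type*} [Ring A] [Algebra ℝ A] [TopologicalSpace A] [IsTopologicalRing A] {𝒜 : Set A}

/-- The semigroup generated by the forward flows `exp (t a)`, `0 ≤ t`, of the elements of `𝒜`: the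
set of points that a control system with the constant generators `𝒜` reaches from the identity. -/
def flowSemigroup (𝒜 : Set A) : Submonoid A :=
  Submonoid.closure {g | ∃ a ∈ 𝒜, ∃ t : ℝ, 0 ≤ t ∧ g = exp (t • a)}

theorem exp_smul_mem_flowSemigroup {a : A} (ha : a ∈ 𝒜) {t : ℝ} (ht : 0 ≤ t) :
    exp (t • a) ∈ flowSemigroup 𝒜 :=
  Submonoid.subset_closure ⟨a, ha, t, ht, rfl⟩

theorem flowSemigroup_le {S : Submonoid A} (hS : ∀ a ∈ 𝒜, ∀ t : ℝ, 0 ≤ t → exp (t • a) ∈ S) :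
    flowSemigroup 𝒜 ≤ S := by
  refine Submonoid.closure_le.2 ?_
  rintro _ ⟨a, ha, t, ht, rfl⟩
  exact hS a ha t ht

end FlowSemigroup

section BanachAlgebra

variable {A : Type*} [NormedRing A] [NormedAlgebra ℝ A]

/-- The point `p` is attained by a family of elements of the semigroup `S`, differentiable in a
Banach space of parameters, whose velocities at `p`, right-translated to the identity, contain
`D`. -/
def IsAttainable (S : Submonoid A) (p : A) (D : Submodule ℝ A) : Prop :=
  ∃ (E : Type) (_ : NormedAddCommGroup E) (_ : NormedSpace ℝ E) (_ : CompleteSpace E)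
    (F : E → A) (F' : E →L[ℝ] A) (x₀ : E), F x₀ = p ∧ HasStrictFDerivAt F F' x₀ ∧
      (∀ᶠ x in 𝓝 x₀, F x ∈ S) ∧ ∀ v ∈ D, ∃ h, F' h = v * p

theorem isAttainable_bot (S : Submonoid A) : IsAttainable S 1 ⊥ :=
  ⟨ℝ, inferInstance, inferInstance, inferInstance, fun _ => 1, 0, 0, rfl,
    hasStrictFDerivAt_const _ _, .of_forall fun _ => S.one_mem,
    fun v hv => ⟨0, by simp [(Submodule.mem_bot ℝ).1 hv]⟩⟩

namespace IsAttainable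

variable {S : Submonoid A} {p : A} {D : Submodule ℝ A}

theorem mem (h : IsAttainable S p D) : p ∈ S := by
  obtain ⟨E, _, _, _, F, F', x₀, rfl, -, hS, -⟩ := h
  exact hS.self_of_nhds

theorem mul_right (h : IsAttainable S p D) {s : A} (hs : s ∈ S) : IsAttainable S (p * s) D := by
  obtain ⟨E, _, _, _, F, F', x₀, rfl, hF, hS, hD⟩ := h
  refine ⟨E, _, ‹_›, ‹_›, fun x => F x * s, _, x₀, rfl, hF.mul_const' s,
    hS.mono fun x hx => mul_mem hx hs, fun v hv => ?_⟩
  obtain ⟨h, hh⟩ := hD v hv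
  exact ⟨h, by simp [hh, mul_assoc]⟩

/-- Following the flow of `a` after reaching `p` adds the direction `p a p⁻¹`. -/
theorem mul_exp [CompleteSpace A] (h : IsAttainable S p D) {a v : A} (hv : v * p = p * a)
    (ha : ∀ t : ℝ, 0 ≤ t → exp (t • a) ∈ S) :
    IsAttainable S (p * exp a) (D ⊔ Submodule.span ℝ {v}) := by
  obtain ⟨E, _, _, _, F, F', x₀, rfl, hF, hS, hD⟩ := h
  have hF₁ : HasStrictFDerivAt (fun y : E × ℝ => F y.1)
      (F'.comp (ContinuousLinearMap.fst ℝ E ℝ)) (x₀, (1 : ℝ)) :=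
    HasStrictFDerivAt.comp (x₀, (1 : ℝ)) hF hasStrictFDerivAt_fst
  have hexp := HasStrictFDerivAt.comp (g := fun t : ℝ => exp (t • a)) (x₀, (1 : ℝ))
    (hasStrictDerivAt_exp_smul_const' (𝕂 := ℝ) a 1).hasStrictFDerivAt
    (hasStrictFDerivAt_snd (𝕜 := ℝ) (E := E) (F := ℝ))
  refine ⟨E × ℝ, inferInstance, inferInstance, inferInstance, fun y => F y.1 * exp (y.2 • a), _,
    (x₀, 1), by simp, hF₁.mul' hexp, ?_, fun w hw => ?_⟩
  · filter_upwards [(continuous_fst.tendsto (x₀, (1 : ℝ))).eventually hS,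
      (continuous_snd.tendsto (x₀, (1 : ℝ))).eventually (lt_mem_nhds one_pos)] with y hy ht
    exact mul_mem hy (ha _ ht.le)
  · obtain ⟨d, hd, z, hz, rfl⟩ := Submodule.mem_sup.1 hw
    obtain ⟨c, rfl⟩ := Submodule.mem_span_singleton.1 hz
    obtain ⟨h, hh⟩ := hD d hd
    refine ⟨(h, c), ?_⟩
    have hvp : v * (F x₀ * exp a) = F x₀ * (a * exp a) := by
      rw [← mul_assoc, hv, mul_assoc]
    simp only [add_mul, smul_mul_assoc, hvp]
    simp [hh, mul_assoc, add_comm]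

end IsAttainable

variable [CompleteSpace A]

theorem hasDerivAt_exp_mul_mul_exp_neg (a w : A) :
    HasDerivAt (fun t : ℝ => exp (t • a) * w * exp (t • -a)) ⁅a, w⁆ 0 := by
  have ha := (hasStrictDerivAt_exp_smul_const (𝕂 := ℝ) a 0).hasDerivAt
  have hna := (hasStrictDerivAt_exp_smul_const (𝕂 := ℝ) (-a) 0).hasDerivAt
  refine ((ha.mul_const w).mul hna).congr_deriv ?_
  simp [Ring.lie_def, sub_eq_add_neg]

theorem lie_mem_of_exp_mul_mul_exp_neg_mem [FiniteDimensional ℝ A] {W : Submodule ℝ A} {a w : A}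
    (h : ∀ t : ℝ, 0 ≤ t → exp (t • a) * w * exp (t • -a) ∈ W) : ⁅a, w⁆ ∈ W := by
  have hderiv := (hasDerivAt_exp_mul_mul_exp_neg a w).hasDerivWithinAt.derivWithin
    (uniqueDiffOn_Ici (0 : ℝ) 0 Set.self_mem_Ici)
  have hclosure := range_derivWithin_subset_closure_span_image
    (fun t : ℝ => exp (t • a) * w * exp (t • -a)) (s := Set.Ici 0) (t := Set.Ici 0)
    (by rw [Set.inter_self]; exact subset_closure) ⟨0, hderiv⟩
  refine closure_minimal (SetLike.coe_subset_coe.2 (Submodule.span_le.2 ?_))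
    W.closed_of_finiteDimensional hclosure
  rintro _ ⟨t, ht, rfl⟩
  exact h t ht

end BanachAlgebra

section CompactGroup

variable {G : Type*} [Group G] [TopologicalSpace G] [IsTopologicalGroup G] [CompactSpace G]

/-- The powers of `u` recur, in particular they come arbitrarily close to `u⁻¹`; hence the
translate of a neighbourhood of `u` in `S` by a suitable power of `u` is a neighbourhood of `1`. -/
theorem submonoid_mem_nhds_one {S : Submonoid G} {u : G} (hu : (S : Set G) ∈ 𝓝 u) :
    (S : Set G) ∈ 𝓝 1 := by
  have hcluster : MapClusterPt u⁻¹ atTop (u ^ · : ℕ → G) :=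
    mapClusterPt_inv_atTop_pow.2 (mapClusterPt_self_atTop_pow u)
  have hinv : ∀ᶠ g in 𝓝 u⁻¹, (S : Set G) ∈ 𝓝 g⁻¹ :=
    continuous_inv.tendsto' u⁻¹ u (inv_inv u) |>.eventually (eventually_mem_nhds_iff.2 hu)
  obtain ⟨m, hm⟩ := (hcluster.frequently hinv).exists
  have htranslate : ∀ᶠ V in 𝓝 (1 : G), (u ^ m)⁻¹ * V ∈ S :=
    (continuous_const_mul (u ^ m)⁻¹).tendsto' 1 _ (mul_one _) |>.eventually hm
  filter_upwards [htranslate] with V hV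
  exact mul_inv_cancel_left (u ^ m) V ▸ mul_mem (pow_mem (mem_of_mem_nhds hu) m) hV

end CompactGroup

section CStarAlgebra

variable {A : Type*} [CStarAlgebra A]

theorem exp_mem_unitary {X : A} (hX : X ∈ skewAdjoint A) : exp X ∈ unitary A :=
  let +nondep : NormedAlgebra ℚ A := .restrictScalars ℚ ℂ A
  exp_mem_unitary_of_mem_skewAdjoint hX

theorem eq_zero_of_exp_mem_unitary {P : A} (hP : IsSelfAdjoint P) (h : exp P ∈ unitary A) :
    P = 0 := by
  let +nondep : NormedAlgebra ℚ A := .restrictScalars ℚ ℂ A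
  have hexp : exp ((2 : ℝ) • P) = exp 0 := by
    rw [two_smul, exp_add_of_commute (Commute.refl P), exp_zero, ← (Unitary.mem_iff.1 h).1,
      star_exp, hP.star_eq]
  have hlog := congrArg CFC.log hexp
  rw [CFC.log_exp _ (IsSelfAdjoint.smul (.all 2) hP), CFC.log_exp _ (.zero A)] at hlog
  exact (smul_eq_zero_iff_right two_ne_zero).1 hlog

/-- In polar coordinates `(P, x) ↦ exp P * F x`, with `P` self-adjoint, a family `F` of unitaries
moving in all skew-adjoint directions fills a neighbourhood in `A`, and the unitaries in this
neighbourhood are those with `P = 0`. -/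
theorem IsAttainable.mem_nhdsWithin_unitary {S : Submonoid A} {p : A} {D : Submodule ℝ A}
    (h : IsAttainable S p D) (hS : S ≤ unitary A)
    (hD : (skewAdjointLie A).toSubmodule ≤ D) : (S : Set A) ∈ 𝓝[unitary A] p := by
  have hp := (Unitary.mem_iff.1 (hS h.mem)).1
  obtain ⟨E, _, _, _, F, F', x₀, rfl, hF, hFS, hF'⟩ := h
  let H := selfAdjoint.submodule ℝ A
  have : CompleteSpace H :=
    (isClosed_eq continuous_star continuous_id).completeSpace_coe (s := (H : Set A))
  let P : E × H →L[ℝ] A := H.subtypeL.comp (ContinuousLinearMap.snd ℝ E H)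
  have hP₀ : exp (P (x₀, 0)) = 1 := by simp [P]
  have hderivF : HasStrictFDerivAt (fun y : E × H => F y.1)
      (F'.comp (ContinuousLinearMap.fst ℝ E H)) (x₀, 0) :=
    HasStrictFDerivAt.comp (x₀, (0 : H)) hF hasStrictFDerivAt_fst
  have hderivExp : HasStrictFDerivAt (fun y => exp (P y)) P (x₀, 0) := by
    have hexp : HasStrictFDerivAt exp (1 : A →L[ℝ] A) (P (x₀, 0)) := by
      simpa [P] using hasStrictFDerivAt_exp_zero (𝕂 := ℝ) (𝔸 := A)
    exact hexp.comp (x₀, (0 : H)) P.hasStrictFDerivAt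
  have hopen := (hderivExp.mul' hderivF).map_nhds_eq_of_surj <| LinearMap.range_eq_top.2 fun y => by
    let z := y * star (F x₀)
    obtain ⟨h, hh⟩ := hF' _ (hD (skewAdjointPart ℝ z).2)
    refine ⟨(h, selfAdjointPart ℝ z), ?_⟩
    change exp (P (x₀, 0)) * F' h + (selfAdjointPart ℝ z : A) * F x₀ = y
    rw [hP₀, one_mul, hh, ← add_mul, add_comm, StarModule.selfAdjointPart_add_skewAdjointPart,
      mul_assoc, hp, mul_one]
  simp only [Pi.mul_apply, hP₀, one_mul] at hopen
  rw [mem_nhdsWithin_iff_eventually, ← hopen, eventually_map]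
  filter_upwards [(continuous_fst.tendsto (x₀, (0 : H))).eventually hFS] with y hy hyu
  have hexp : exp (P y) ∈ unitary A := by
    simpa [mul_assoc, (Unitary.mem_iff.1 (hS hy)).2] using
      mul_mem hyu (Unitary.star_mem (hS hy))
  have hPy : P y = 0 := eq_zero_of_exp_mem_unitary y.2.2 hexp
  simpa [hPy] using hy

instance [FiniteDimensional ℝ A] : CompactSpace (unitary A) := by
  have : ProperSpace A := FiniteDimensional.proper ℝ A
  refine isCompact_iff_compactSpace.1 ((isCompact_closedBall (0 : A) ‖(1 : A)‖).of_isClosed_subset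
    isClosed_unitary fun u hu => ?_)
  simpa using (CStarRing.norm_coe_unitary_mul ⟨u, hu⟩ (1 : A)).le

theorem exp_mem_of_mem_nhdsWithin_unitary {S : Submonoid A} (hS : (S : Set A) ∈ 𝓝[unitary A] 1)
    {X : A} (hX : X ∈ skewAdjoint A) : exp X ∈ S := by
  have hlim : Tendsto (fun t : ℝ => exp (t • X)) (𝓝 0) (𝓝[unitary A] 1) := by
    refine tendsto_nhdsWithin_iff.2
      ⟨?_, .of_forall fun t => exp_mem_unitary (skewAdjoint.smul_mem t hX)⟩
    simpa using (hasStrictDerivAt_exp_smul_const (𝕂 := ℝ) X 0).hasDerivAt.continuousAt.tendsto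
  obtain ⟨k, hk⟩ := ((hlim.comp (tendsto_one_div_add_atTop_nhds_zero_nat (𝕜 := ℝ))).eventually
    hS).exists
  have hroot : exp ((1 / ((k : ℝ) + 1)) • X) ^ (k + 1) = exp X := by
    let +nondep : NormedAlgebra ℚ A := .restrictScalars ℚ ℂ A
    rw [← exp_nsmul, ← Nat.cast_smul_eq_nsmul ℝ, smul_smul, Nat.cast_succ,
      mul_one_div_cancel (Nat.cast_add_one_ne_zero k), one_smul]
  exact hroot ▸ pow_mem hk (k + 1)

variable {𝒜 : Set A}

theorem flowSemigroup_le_unitary (h𝒜 : 𝒜 ⊆ skewAdjoint A) : flowSemigroup 𝒜 ≤ unitary A :=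
  flowSemigroup_le fun _ ha t _ => exp_mem_unitary (skewAdjoint.smul_mem t (h𝒜 ha))

variable [FiniteDimensional ℝ A]

theorem lieSpan_le_span_flowSemigroup_conj (h𝒜 : 𝒜 ⊆ skewAdjoint A) :
    (LieSubalgebra.lieSpan ℝ A 𝒜).toSubmodule ≤
      Submodule.span ℝ {y | ∃ s ∈ flowSemigroup 𝒜, ∃ a ∈ 𝒜, y = s * a * star s} := by
  refine lieSpan_le_of_lie_mem
    (fun a ha => Submodule.subset_span ⟨1, one_mem _, a, ha, by simp⟩)
    fun a ha w hw => lie_mem_of_exp_mul_mul_exp_neg_mem fun t ht => ?_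
  have hstar : exp (t • -a) = star (exp (t • a)) := by
    rw [star_exp, star_smul, skewAdjoint.mem_iff.1 (h𝒜 ha), star_trivial]
  rw [hstar]
  have hs := exp_smul_mem_flowSemigroup ha ht
  induction hw using Submodule.span_induction with
  | mem y hy =>
    obtain ⟨s, hs', b, hb, rfl⟩ := hy
    exact Submodule.subset_span ⟨_, mul_mem hs hs', b, hb, by simp [mul_assoc]⟩
  | zero => simp
  | add y z _ _ hy hz => simpa [mul_add, add_mul] using add_mem hy hz
  | smul c y _ hy => simpa using Submodule.smul_mem _ c hy

theorem exists_isAttainable_skewAdjointLie_le (h𝒜 : 𝒜 ⊆ skewAdjoint A)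
    (hgen : skewAdjointLie A ≤ LieSubalgebra.lieSpan ℝ A 𝒜) :
    ∃ p D, IsAttainable (flowSemigroup 𝒜) p D ∧ (skewAdjointLie A).toSubmodule ≤ D := by
  obtain ⟨D, ⟨p, hp⟩, hmax⟩ := WellFounded.has_min (wellFounded_gt (α := Submodule ℝ A))
    {D | ∃ p, IsAttainable (flowSemigroup 𝒜) p D} ⟨⊥, 1, isAttainable_bot _⟩
  refine ⟨p, D, hp, fun x hx => ?_⟩
  have hstar_mul : ∀ {s : A}, s ∈ flowSemigroup 𝒜 → star s * s = 1 := fun hs =>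
    (Unitary.mem_iff.1 (flowSemigroup_le_unitary h𝒜 hs)).1
  have hconj : ∀ s ∈ flowSemigroup 𝒜, ∀ a ∈ 𝒜, p * s * a * star (p * s) ∈ D := by
    intro s hs a ha
    have hlarger := (hp.mul_right hs).mul_exp (a := a) (v := p * s * a * star (p * s))
      (by rw [mul_assoc, hstar_mul (mul_mem hp.mem hs), mul_one])
      fun t ht => exp_smul_mem_flowSemigroup ha ht
    have hD := eq_of_le_of_not_lt le_sup_left (hmax _ ⟨_, hlarger⟩)
    exact hD ▸ Submodule.mem_sup_right (Submodule.mem_span_singleton_self _)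
  have hspan : Submodule.span ℝ {y | ∃ s ∈ flowSemigroup 𝒜, ∃ a ∈ 𝒜, y = s * a * star s} ≤
      D.comap (LinearMap.mulRight ℝ (star p) ∘ₗ LinearMap.mulLeft ℝ p) := by
    refine Submodule.span_le.2 ?_
    rintro _ ⟨s, hs, a, ha, rfl⟩
    simpa [mul_assoc] using hconj s hs a ha
  have hpx := hspan (lieSpan_le_span_flowSemigroup_conj h𝒜
    (hgen (skewAdjoint.conjugate' hx p)))
  have hpp := (Unitary.mem_iff.1 (flowSemigroup_le_unitary h𝒜 hp.mem)).2
  have hcancel : p * (star p * x * p) * star p = x := by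
    rw [← mul_assoc, ← mul_assoc, hpp, one_mul, mul_assoc, hpp, mul_one]
  exact hcancel ▸ hpx

theorem exp_mem_flowSemigroup (h𝒜 : 𝒜 ⊆ skewAdjoint A)
    (hgen : skewAdjointLie A ≤ LieSubalgebra.lieSpan ℝ A 𝒜) {X : A} (hX : X ∈ skewAdjoint A) :
    exp X ∈ flowSemigroup 𝒜 := by
  obtain ⟨p, D, hp, hD⟩ := exists_isAttainable_skewAdjointLie_le h𝒜 hgen
  have hle := flowSemigroup_le_unitary h𝒜
  have hnhds : Subtype.val ⁻¹' (flowSemigroup 𝒜 : Set A) ∈ 𝓝 (⟨p, hle hp.mem⟩ : unitary A) :=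
    preimage_coe_mem_nhds_subtype.2 (hp.mem_nhdsWithin_unitary hle hD)
  have hone : Subtype.val ⁻¹' (flowSemigroup 𝒜 : Set A) ∈ 𝓝 (1 : unitary A) :=
    submonoid_mem_nhds_one (S := (flowSemigroup 𝒜).comap (unitary A).subtype) hnhds
  exact exp_mem_of_mem_nhdsWithin_unitary (preimage_coe_mem_nhds_subtype.1 hone) hX

end CStarAlgebra

end Reachability

section MatrixExponential

open NormedSpace

theorem exists_skewAdjoint_exp_eq_of_finite_spectrum {A : Type*} [CStarAlgebra A] {u : A}
    (hu : u ∈ unitary A) (hfin : (spectrum ℂ u).Finite) : ∃ X ∈ skewAdjoint A, exp X = u := by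
  have hnormal : IsStarNormal u := ⟨(Unitary.mem_iff.1 hu).1.trans (Unitary.mem_iff.1 hu).2.symm⟩
  have hnorm : ∀ z ∈ spectrum ℂ u, ‖z‖ = 1 := fun z hz => spectrum.norm_eq_one_of_unitary hu hz
  have hlog : ContinuousOn Complex.log (spectrum ℂ u) := hfin.continuousOn _
  refine ⟨cfc Complex.log u, ?_, ?_⟩
  · rw [skewAdjoint.mem_iff, ← cfc_star, ← cfc_neg]
    refine cfc_congr fun z hz => ?_
    have hre : (Complex.log z).re = 0 := by rw [Complex.log_re, hnorm z hz, Real.log_one]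
    apply Complex.ext <;> simp [hre]
  · rw [← CFC.complex_exp_eq_normedSpace_exp (cfc_predicate _ _),
      ← cfc_comp Complex.exp Complex.log u]
    conv_rhs => rw [← cfc_id ℂ u]
    exact cfc_congr fun z hz => Complex.exp_log (norm_ne_zero_iff.1 (by simp [hnorm z hz]))

variable {n : Type*} [Fintype n] [DecidableEq n]

open scoped Matrix.Norms.L2Operator in
theorem exists_skewAdjoint_exp_eq {V : Matrix n n ℂ} (hV : V ∈ Matrix.unitaryGroup n ℂ) :
    ∃ X ∈ skewAdjoint (Matrix n n ℂ), exp X = V :=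
  exists_skewAdjoint_exp_eq_of_finite_spectrum hV V.finite_spectrum

open scoped Matrix.Norms.L2Operator in
theorem exp_mem_unitaryGroup {X : Matrix n n ℂ} (hX : X ∈ skewAdjoint (Matrix n n ℂ)) :
    exp X ∈ Matrix.unitaryGroup n ℂ :=
  exp_mem_unitary hX

theorem exists_eq_conj_diagonal {X : Matrix n n ℂ} (hX : X ∈ skewAdjoint (Matrix n n ℂ)) :
    ∃ W ∈ Matrix.unitaryGroup n ℂ, ∃ θ : n → ℝ,
      X = W * Matrix.diagonal (fun i => Complex.I * (θ i : ℂ)) * star W := by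
  have hH : (-Complex.I • X).IsHermitian := by
    rw [Matrix.IsHermitian, ← Matrix.star_eq_conjTranspose, star_smul, skewAdjoint.mem_iff.1 hX]
    simp
  refine ⟨hH.eigenvectorUnitary, hH.eigenvectorUnitary.2, hH.eigenvalues, ?_⟩
  have h := congrArg (Complex.I • ·) hH.spectral_theorem
  simp only [Unitary.conjStarAlgAut_apply, smul_smul, mul_neg, Complex.I_mul_I, neg_neg,
    one_smul] at h
  rwa [← smul_mul_assoc, ← mul_smul_comm, ← Matrix.diagonal_smul] at h

theorem conj_diagonal_mem_skewAdjoint (W : Matrix n n ℂ) (θ : n → ℝ) :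
    W * Matrix.diagonal (fun i => Complex.I * (θ i : ℂ)) * star W ∈ skewAdjoint (Matrix n n ℂ) := by
  have hθ : (Matrix.diagonal fun i => (θ i : ℂ)).IsHermitian :=
    Matrix.isHermitian_diagonal_of_self_adjoint _ (funext fun _ => Complex.conj_ofReal _)
  have hdiag : Matrix.diagonal (fun i => Complex.I * (θ i : ℂ)) =
      Complex.I • Matrix.diagonal fun i => (θ i : ℂ) :=
    Matrix.diagonal_smul Complex.I _
  rw [hdiag]
  exact skewAdjoint.conjugate (I_smul_mem_skewAdjoint hθ) W

theorem exp_conj_diagonal {W : Matrix n n ℂ} (hW : W ∈ Matrix.unitaryGroup n ℂ) (v : n → ℂ) :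
    exp (W * Matrix.diagonal v * star W) =
      W * Matrix.diagonal (fun i => Complex.exp (v i)) * star W := by
  have hexp : exp v = fun i => Complex.exp (v i) := by
    ext i
    rw [Pi.coe_exp, Complex.exp_eq_exp_ℂ]
  rw [← hexp, ← Matrix.exp_diagonal]
  exact Matrix.exp_units_conj (Unitary.toUnits ⟨W, hW⟩) (Matrix.diagonal v)

theorem trace_conj_diagonal {W : Matrix n n ℂ} (hW : W ∈ Matrix.unitaryGroup n ℂ) (v : n → ℂ) :
    (W * Matrix.diagonal v * star W).trace = ∑ i, v i := by
  rw [Matrix.trace_mul_comm, ← mul_assoc, (Unitary.mem_iff.1 hW).1, one_mul, Matrix.trace_diagonal]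

theorem det_conj_diagonal {W : Matrix n n ℂ} (hW : W ∈ Matrix.unitaryGroup n ℂ) (v : n → ℂ) :
    (W * Matrix.diagonal v * star W).det = ∏ i, v i := by
  rw [Matrix.det_mul_comm, ← mul_assoc, (Unitary.mem_iff.1 hW).1, one_mul, Matrix.det_diagonal]

theorem det_exp {X : Matrix n n ℂ} (hX : X ∈ skewAdjoint (Matrix n n ℂ)) :
    (exp X).det = Complex.exp X.trace := by
  obtain ⟨W, hW, θ, rfl⟩ := exists_eq_conj_diagonal hX
  rw [exp_conj_diagonal hW, det_conj_diagonal hW, trace_conj_diagonal hW, Complex.exp_sum]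

theorem exp_mem_specialUnitaryGroup {X : Matrix n n ℂ} (hX : X ∈ specialUnitaryLie n) :
    exp X ∈ Matrix.specialUnitaryGroup n ℂ :=
  Matrix.mem_specialUnitaryGroup_iff.2 ⟨exp_mem_unitaryGroup hX.1, by
    rw [det_exp hX.1, (mem_specialUnitaryLie.1 hX).2, Complex.exp_zero]⟩

variable [Nonempty n]

/-- The trace of a skew-adjoint logarithm of `V` is an integer multiple of `2πi`, which is removed
by shifting a single eigenvalue. -/
theorem exists_mem_specialUnitaryLie_exp_eq {V : Matrix n n ℂ}
    (hV : V ∈ Matrix.specialUnitaryGroup n ℂ) : ∃ X ∈ specialUnitaryLie n, exp X = V := by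
  obtain ⟨hVu, hVd⟩ := Matrix.mem_specialUnitaryGroup_iff.1 hV
  obtain ⟨X, hX, rfl⟩ := exists_skewAdjoint_exp_eq hVu
  rw [det_exp hX] at hVd
  obtain ⟨m, hm⟩ := Complex.exp_eq_one_iff.1 hVd
  obtain ⟨W, hW, θ, rfl⟩ := exists_eq_conj_diagonal hX
  obtain ⟨i₀⟩ := ‹Nonempty n›
  refine ⟨_, ⟨conj_diagonal_mem_skewAdjoint W (θ - Pi.single i₀ (2 * Real.pi * m)), ?_⟩, ?_⟩
  · change Matrix.trace _ = 0
    rw [trace_conj_diagonal hW] at hm ⊢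
    simp only [Pi.sub_apply, Complex.ofReal_sub, mul_sub, Finset.sum_sub_distrib, hm]
    rw [← Finset.mul_sum, ← Complex.ofReal_sum, Fintype.sum_pi_single']
    push_cast
    ring
  · rw [exp_conj_diagonal hW, exp_conj_diagonal hW]
    congr 3
    ext i
    rcases eq_or_ne i i₀ with rfl | h
    · rw [Pi.sub_apply, Pi.single_eq_same, Complex.exp_eq_exp_iff_exists_int]
      exact ⟨-m, by push_cast; ring⟩
    · simp [h]

theorem exists_pow_eq_of_mem_specialUnitaryGroup {V : Matrix n n ℂ}
    (hV : V ∈ Matrix.specialUnitaryGroup n ℂ) {k : ℕ} (hk : k ≠ 0) :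
    ∃ W ∈ Matrix.specialUnitaryGroup n ℂ, W ^ k = V := by
  obtain ⟨X, hX, rfl⟩ := exists_mem_specialUnitaryLie_exp_eq hV
  refine ⟨exp ((k : ℝ)⁻¹ • X),
    exp_mem_specialUnitaryGroup ((specialUnitaryLie n).smul_mem _ hX), ?_⟩
  rw [← Matrix.exp_nsmul, ← Nat.cast_smul_eq_nsmul ℝ, smul_smul,
    mul_inv_cancel₀ (Nat.cast_ne_zero.2 hk), one_smul]

end MatrixExponential

section Controllability

open NormedSpace

theorem exists_eq_smul_of_mem_flowSemigroup_insert {A : Type*} [NormedRing A] [NormedAlgebra ℂ A]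
    {𝒜 : Set A} {V : A} (hV : V ∈ flowSemigroup (insert (Complex.I • 1) 𝒜)) :
    ∃ c : ℂ, ∃ s ∈ flowSemigroup 𝒜, V = c • s := by
  induction hV using Submonoid.closure_induction with
  | mem g hg =>
    obtain ⟨a, rfl | ha, t, ht, rfl⟩ := hg
    · refine ⟨exp (t * Complex.I), 1, one_mem _, ?_⟩
      rw [← Algebra.algebraMap_eq_smul_one (exp _), algebraMap_exp_comm,
        Algebra.algebraMap_eq_smul_one, mul_smul, Complex.coe_smul]
    · exact ⟨1, _, exp_smul_mem_flowSemigroup ha ht, (one_smul _ _).symm⟩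
  | one => exact ⟨1, 1, one_mem _, (one_smul _ _).symm⟩
  | mul g h _ _ hg hh =>
    obtain ⟨c, s, hs, rfl⟩ := hg
    obtain ⟨c', s', hs', rfl⟩ := hh
    exact ⟨c * c', s * s', mul_mem hs hs', smul_mul_smul_comm c s c' s'⟩

variable {n : Type*} [Fintype n] [DecidableEq n] {𝒜 : Set (Matrix n n ℂ)}

open scoped Matrix.Norms.L2Operator in
theorem unitaryGroup_le_flowSemigroup (h𝒜 : 𝒜 ⊆ skewAdjoint (Matrix n n ℂ))
    (hgen : skewAdjointLie (Matrix n n ℂ) ≤ LieSubalgebra.lieSpan ℝ _ 𝒜) :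
    Matrix.unitaryGroup n ℂ ≤ flowSemigroup 𝒜 := by
  intro V hV
  obtain ⟨X, hX, rfl⟩ := exists_skewAdjoint_exp_eq hV
  exact exp_mem_flowSemigroup h𝒜 hgen hX

variable [Nonempty n]

/-- With the scalar `i` as an additional generator every unitary is reached, so each `W` in `SU(N)`
is a scalar `c` times an element reached by the flows of `𝒜`. Determinants give `c ^ N = 1`, hence
`W ^ N` is reached, and every element of `SU(N)` is such a power. -/
theorem specialUnitaryGroup_le_flowSemigroup_of_subset (h𝒜 : 𝒜 ⊆ specialUnitaryLie n)
    (hgen : specialUnitaryLie n ≤ LieSubalgebra.lieSpan ℝ _ 𝒜) :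
    Matrix.specialUnitaryGroup n ℂ ≤ flowSemigroup 𝒜 := by
  intro V hV
  obtain ⟨W, hW, rfl⟩ := exists_pow_eq_of_mem_specialUnitaryGroup hV (Fintype.card_ne_zero (α := n))
  obtain ⟨hWu, hWd⟩ := Matrix.mem_specialUnitaryGroup_iff.1 hW
  have hscalar : Complex.I • (1 : Matrix n n ℂ) ∈ skewAdjoint (Matrix n n ℂ) :=
    I_smul_mem_skewAdjoint Matrix.isHermitian_one
  have htrace : (Complex.I • (1 : Matrix n n ℂ)).trace ≠ 0 := by
    rw [Matrix.trace_smul, Matrix.trace_one]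
    exact smul_ne_zero Complex.I_ne_zero (Nat.cast_ne_zero.2 Fintype.card_ne_zero)
  have hgen' : skewAdjointLie (Matrix n n ℂ) ≤
      LieSubalgebra.lieSpan ℝ _ (insert (Complex.I • 1) 𝒜) :=
    skewAdjointLie_le_of_specialUnitaryLie_le
      (hgen.trans (LieSubalgebra.lieSpan_mono (Set.subset_insert _ _)))
      (LieSubalgebra.subset_lieSpan (Set.mem_insert _ _)) hscalar htrace
  obtain ⟨c, s, hs, rfl⟩ : ∃ c : ℂ, ∃ s ∈ flowSemigroup 𝒜, W = c • s :=
    open scoped Matrix.Norms.L2Operator in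
    exists_eq_smul_of_mem_flowSemigroup_insert (unitaryGroup_le_flowSemigroup
      (Set.insert_subset hscalar fun a ha => (h𝒜 ha).1) hgen' hWu)
  have hdet : s.det = 1 := (Matrix.mem_specialUnitaryGroup_iff.1 (flowSemigroup_le (fun a ha t _ =>
    exp_mem_specialUnitaryGroup ((specialUnitaryLie n).smul_mem t (h𝒜 ha))) hs)).2
  rw [Matrix.det_smul, hdet, mul_one] at hWd
  rw [smul_pow, hWd, one_smul]
  exact pow_mem hs _

theorem specialUnitaryGroup_le_flowSemigroup (h𝒜 : 𝒜 ⊆ skewAdjoint (Matrix n n ℂ))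
    (hgen : specialUnitaryLie n ≤ LieSubalgebra.lieSpan ℝ _ 𝒜) :
    Matrix.specialUnitaryGroup n ℂ ≤ flowSemigroup 𝒜 := by
  by_cases htrace : ∀ a ∈ 𝒜, a.trace = 0
  · exact specialUnitaryGroup_le_flowSemigroup_of_subset
      (fun a ha => mem_specialUnitaryLie.2 ⟨h𝒜 ha, htrace a ha⟩) hgen
  · push Not at htrace
    obtain ⟨a, ha, ha0⟩ := htrace
    exact Matrix.specialUnitaryGroup_le_unitaryGroup.trans (unitaryGroup_le_flowSemigroup h𝒜
      (skewAdjointLie_le_of_specialUnitaryLie_le hgen (LieSubalgebra.subset_lieSpan ha)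
        (h𝒜 ha) ha0))

end Controllability

section DynamicalLieGroup

variable {n ι : Type*} [Fintype n] [DecidableEq n] {Hd : Matrix n n ℂ} {Hc : ι → Matrix n n ℂ}

theorem I_smul_drift_mem_dynamicalLieAlgebra : Complex.I • Hd ∈ dynamicalLieAlgebra Hd Hc :=
  LieSubalgebra.subset_lieSpan (Set.mem_insert _ _)

theorem I_smul_control_mem_dynamicalLieAlgebra (j : ι) :
    Complex.I • Hc j ∈ dynamicalLieAlgebra Hd Hc :=
  LieSubalgebra.subset_lieSpan (Set.mem_insert_of_mem _ ⟨j, rfl⟩)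

theorem dynamicalLieGroup_le_unitaryGroup
    (hHd : Complex.I • Hd ∈ skewAdjoint (Matrix n n ℂ))
    (hHc : ∀ j, Complex.I • Hc j ∈ skewAdjoint (Matrix n n ℂ)) :
    dynamicalLieGroup Hd Hc ≤ Matrix.unitaryGroup n ℂ := by
  have hle : dynamicalLieAlgebra Hd Hc ≤ skewAdjointLie (Matrix n n ℂ) :=
    LieSubalgebra.lieSpan_le.2 (Set.insert_subset hHd (Set.range_subset_iff.2 hHc))
  refine Submonoid.closure_le.2 ?_
  rintro _ ⟨X, hX, rfl⟩
  exact exp_mem_unitaryGroup (hle hX)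

theorem unitaryGroup_le_dynamicalLieGroup
    (h : skewAdjointLie (Matrix n n ℂ) ≤ dynamicalLieAlgebra Hd Hc) :
    Matrix.unitaryGroup n ℂ ≤ dynamicalLieGroup Hd Hc := by
  intro V hV
  obtain ⟨X, hX, rfl⟩ := exists_skewAdjoint_exp_eq hV
  exact Submonoid.subset_closure ⟨X, h hX, rfl⟩

theorem specialUnitaryGroup_le_dynamicalLieGroup [Nonempty n]
    (h : specialUnitaryLie n ≤ dynamicalLieAlgebra Hd Hc) :
    Matrix.specialUnitaryGroup n ℂ ≤ dynamicalLieGroup Hd Hc := by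
  intro V hV
  obtain ⟨X, hX, rfl⟩ := exists_mem_specialUnitaryLie_exp_eq hV
  exact Submonoid.subset_closure ⟨X, h hX, rfl⟩

theorem dynamicalLieGroup_eq_unitaryGroup (htrace : Hd.trace ≠ 0)
    (hHd : Complex.I • Hd ∈ skewAdjoint (Matrix n n ℂ))
    (hHc : ∀ j, Complex.I • Hc j ∈ skewAdjoint (Matrix n n ℂ))
    (h : specialUnitaryLie n ≤ dynamicalLieAlgebra Hd Hc) :
    dynamicalLieGroup Hd Hc = Matrix.unitaryGroup n ℂ := by
  have htrace' : (Complex.I • Hd).trace ≠ 0 := by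
    rw [Matrix.trace_smul]
    exact smul_ne_zero Complex.I_ne_zero htrace
  exact (dynamicalLieGroup_le_unitaryGroup hHd hHc).antisymm (unitaryGroup_le_dynamicalLieGroup
    (skewAdjointLie_le_of_specialUnitaryLie_le h I_smul_drift_mem_dynamicalLieAlgebra hHd htrace'))

end DynamicalLieGroup

section Blockade

theorem annihilation_single_zero : annihilation (Finsupp.single 0 1) = 0 := by
  simp [annihilation]

theorem annihilation_single_succ (n : ℕ) :
    annihilation (Finsupp.single (n + 1) 1) = (√((n : ℝ) + 1) : ℂ) • Finsupp.single n 1 := by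
  simp [annihilation]

theorem creation_single (n : ℕ) :
    creation (Finsupp.single n 1) = (√((n : ℝ) + 1) : ℂ) • Finsupp.single (n + 1) 1 := by
  simp [creation]

theorem number_single (n : ℕ) :
    number (Finsupp.single n 1) = (n : ℂ) • Finsupp.single n 1 := by
  rcases n with _ | n
  · simp [number, annihilation_single_zero]
  · rw [number, Module.End.mul_apply, annihilation_single_succ, map_smul, creation_single,
      smul_smul, ← Complex.ofReal_mul, Real.mul_self_sqrt (by positivity)]
    push_cast
    rfl

theorem creation_sq_mul_annihilation_sq :
    creation ^ 2 * annihilation ^ 2 = creation * number * annihilation := by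
  rw [number]
  noncomm_ring

theorem creation_sq_mul_annihilation_sq_single (n : ℕ) :
    (creation ^ 2 * annihilation ^ 2) (Finsupp.single n 1) =
      ((n : ℂ) ^ 2 - n) • Finsupp.single n 1 := by
  rw [creation_sq_mul_annihilation_sq, Module.End.mul_apply, Module.End.mul_apply]
  rcases n with _ | n
  · simp [annihilation_single_zero]
  · rw [annihilation_single_succ, map_smul, map_smul, number_single, map_smul, smul_comm,
      ← map_smul, ← annihilation_single_succ, ← Module.End.mul_apply, ← number, number_single,
      smul_smul]
    push_cast
    ring_nf

/-- The amplitude `(k - r) √(k + 1)` of the transition `|k⟩ → |k + 1⟩`, for every Fock state `k`;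
on the blockade subspace it is `coupling r`. -/
def fockCoupling (r k : ℕ) : ℝ :=
  ((k : ℝ) - r) * √((k : ℝ) + 1)

theorem driveHamiltonian_single_zero (χ Δ₀ : ℝ) (r : ℕ) (α : ℂ) :
    driveHamiltonian χ Δ₀ r α (Finsupp.single 0 1) =
      (χ * α * fockCoupling r 0) • Finsupp.single 1 1 := by
  simp only [driveHamiltonian, LinearMap.add_apply, LinearMap.smul_apply, LinearMap.sub_apply,
    Module.End.mul_apply creation (number - _), Module.End.mul_apply (number - _) annihilation,
    creation_sq_mul_annihilation_sq_single, number_single, annihilation_single_zero,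
    creation_single, map_smul, map_sub, map_zero, Module.End.one_apply, fockCoupling]
  push_cast
  module

theorem driveHamiltonian_single_succ (χ Δ₀ : ℝ) (r : ℕ) (α : ℂ) (n : ℕ) :
    driveHamiltonian χ Δ₀ r α (Finsupp.single (n + 1) 1) =
      (energy χ Δ₀ (n + 1) : ℂ) • Finsupp.single (n + 1) 1 +
        (χ * α * fockCoupling r (n + 1)) • Finsupp.single (n + 2) 1 +
        (χ * star α * fockCoupling r n) • Finsupp.single n 1 := by
  simp only [driveHamiltonian, LinearMap.add_apply, LinearMap.smul_apply, LinearMap.sub_apply,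
    Module.End.mul_apply creation (number - _), Module.End.mul_apply (number - _) annihilation,
    creation_sq_mul_annihilation_sq_single, number_single, annihilation_single_succ,
    creation_single, map_smul, map_sub, Module.End.one_apply, fockCoupling, energy]
  push_cast
  module

theorem driveHamiltonian_single_apply (χ Δ₀ : ℝ) (r : ℕ) (α : ℂ) (m n : ℕ) :
    driveHamiltonian χ Δ₀ r α (Finsupp.single n 1) m =
      (if m = n then (energy χ Δ₀ m : ℂ) else 0) +
        (if m = n + 1 then χ * α * fockCoupling r n else 0) +
        (if n = m + 1 then χ * star α * fockCoupling r m else 0) := by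
  rcases n with _ | n
  · have henergy : (if m = 0 then (energy χ Δ₀ m : ℂ) else 0) = 0 := by
      simp +contextual [energy]
    rw [driveHamiltonian_single_zero, henergy, Finsupp.smul_apply, Finsupp.single_apply,
      if_neg (Nat.succ_ne_zero m).symm]
    simp [eq_comm (a := m)]
  · rw [driveHamiltonian_single_succ]
    simp only [Finsupp.add_apply, Finsupp.smul_apply, Finsupp.single_apply, smul_eq_mul, mul_ite,
      mul_one, mul_zero]
    grind

variable {r : ℕ}

theorem sum_smul_single_succ_castSucc_apply (f : ℕ → ℂ) (m n : Fin (r + 1)) :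
    (∑ k : Fin r, f k • Matrix.single k.succ k.castSucc (1 : ℂ)) m n =
      if (m : ℕ) = n + 1 then f n else 0 := by
  rw [Matrix.sum_apply]
  split_ifs with h
  · obtain ⟨k, rfl⟩ := Fin.exists_castSucc_eq.2 (show n ≠ Fin.last r by
      rintro rfl
      exact (h ▸ m.2).ne rfl)
    obtain rfl : m = k.succ := Fin.ext h
    rw [Finset.sum_eq_single k (fun j _ hj => by simp [hj]) (by simp)]
    simp
  · refine Finset.sum_eq_zero fun k _ => ?_
    have hk : ¬(k.succ = m ∧ k.castSucc = n) := by
      rintro ⟨rfl, rfl⟩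
      exact h rfl
    simp [hk]

theorem sum_smul_single_castSucc_succ_apply (f : ℕ → ℂ) (m n : Fin (r + 1)) :
    (∑ k : Fin r, f k • Matrix.single k.castSucc k.succ (1 : ℂ)) m n =
      if (n : ℕ) = m + 1 then f m else 0 := by
  rw [← sum_smul_single_succ_castSucc_apply f n m,
    ← Matrix.transpose_apply (∑ k : Fin r, f k • Matrix.single k.succ k.castSucc 1),
    Matrix.transpose_sum]
  simp only [Matrix.transpose_smul, Matrix.transpose_single]

theorem smul_controlRe_add_smul_controlIm (x y : ℂ) : x • controlRe r + y • controlIm r =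
    ∑ k : Fin r, ((x + y * Complex.I) * fockCoupling r k) • Matrix.single k.succ k.castSucc 1 +
      ∑ k : Fin r, ((x - y * Complex.I) * fockCoupling r k) •
        Matrix.single k.castSucc k.succ 1 := by
  rw [controlRe, controlIm, Finset.smul_sum, Finset.smul_sum, ← Finset.sum_add_distrib,
    ← Finset.sum_add_distrib]
  refine Finset.sum_congr rfl fun k _ => ?_
  rw [show coupling r k = fockCoupling r k from rfl]
  module

theorem blockade_driveHamiltonian (χ Δ₀ : ℝ) (r : ℕ) (α : ℂ) :
    blockade r (driveHamiltonian χ Δ₀ r α) =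
      drift χ Δ₀ r + ((χ * α.re : ℝ) : ℂ) • controlRe r
        + ((χ * α.im : ℝ) : ℂ) • controlIm r := by
  have hα : ((χ * α.re : ℝ) : ℂ) + ((χ * α.im : ℝ) : ℂ) * Complex.I = χ * α := by
    apply Complex.ext <;> simp
  have hstar : ((χ * α.re : ℝ) : ℂ) - ((χ * α.im : ℝ) : ℂ) * Complex.I = χ * star α := by
    apply Complex.ext <;> simp
  ext m n
  rw [add_assoc, smul_controlRe_add_smul_controlIm, hα, hstar, blockade, Matrix.of_apply,
    driveHamiltonian_single_apply, Matrix.add_apply, Matrix.add_apply,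
    sum_smul_single_succ_castSucc_apply fun k => χ * α * fockCoupling r k,
    sum_smul_single_castSucc_succ_apply fun k => χ * star α * fockCoupling r k, add_assoc,
    drift, Matrix.diagonal_apply]
  simp only [Fin.ext_iff]
  rfl

end Blockade

section Concatenation

open MeasureTheory

variable {E F G : Type*} {T T' t : ℝ}

/-- The path following `f` up to time `T` and `g`, restarted from its time `0`, afterwards. -/
def concat (T : ℝ) (f g : ℝ → E) : ℝ → E := fun t => if t ≤ T then f t else g (t - T)

theorem concat_of_le {f g : ℝ → E} (h : t ≤ T) : concat T f g t = f t := if_pos h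

theorem concat_of_lt {f g : ℝ → E} (h : T < t) : concat T f g t = g (t - T) := if_neg h.not_ge

theorem concat_of_ge {f g : ℝ → E} (hfg : f T = g 0) (h : T ≤ t) :
    concat T f g t = g (t - T) := by
  rcases h.eq_or_lt with rfl | h
  · rw [concat_of_le le_rfl, hfg, sub_self]
  · exact concat_of_lt h

theorem concat_map (φ : E → F) (f g : ℝ → E) :
    (fun t => φ (concat T f g t)) = concat T (fun t => φ (f t)) fun t => φ (g t) :=
  funext fun _ => apply_ite φ _ _ _

theorem concat_map₂ (φ : E → F → G) (f g : ℝ → E) (f' g' : ℝ → F) :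
    (fun t => φ (concat T f g t) (concat T f' g' t)) =
      concat T (fun t => φ (f t) (f' t)) fun t => φ (g t) (g' t) := by
  funext t
  rcases le_or_gt t T with h | h
  · simp only [concat_of_le h]
  · simp only [concat_of_lt h]

theorem measurable_concat [MeasurableSpace E] {f g : ℝ → E} (hf : Measurable f)
    (hg : Measurable g) : Measurable (concat T f g) :=
  Measurable.ite measurableSet_Iic hf (hg.comp (measurable_id.sub_const T))

theorem continuousOn_concat [TopologicalSpace E] {f g : ℝ → E} (hT : 0 ≤ T) (hT' : 0 ≤ T')
    (hf : ContinuousOn f (Set.Icc 0 T)) (hg : ContinuousOn g (Set.Icc 0 T')) (hfg : f T = g 0) :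
    ContinuousOn (concat T f g) (Set.Icc 0 (T + T')) := by
  rw [← Set.Icc_union_Icc_eq_Icc hT (le_add_of_nonneg_right hT')]
  refine ContinuousOn.union_of_isClosed (hf.congr fun t ht => concat_of_le ht.2) ?_
    isClosed_Icc isClosed_Icc
  refine ContinuousOn.congr (hg.comp (continuousOn_id.sub continuousOn_const) fun t ht => ?_)
    fun t ht => concat_of_ge hfg ht.1
  exact ⟨sub_nonneg.2 ht.1, sub_le_iff_le_add'.2 ht.2⟩

variable [NormedAddCommGroup E] {f g : ℝ → E}

theorem intervalIntegrable_concat_left (ht : 0 ≤ t) (htT : t ≤ T)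
    (hf : IntervalIntegrable f volume 0 t) : IntervalIntegrable (concat T f g) volume 0 t :=
  hf.congr fun _ hs => (concat_of_le ((Set.uIoc_of_le ht ▸ hs).2.trans htT)).symm

theorem intervalIntegrable_concat_right (hTt : T ≤ t)
    (hg : IntervalIntegrable g volume 0 (t - T)) :
    IntervalIntegrable (concat T f g) volume T t := by
  have hshift := hg.comp_sub_right T
  rw [zero_add, sub_add_cancel] at hshift
  exact hshift.congr fun _ hs => (concat_of_lt (Set.uIoc_of_le hTt ▸ hs).1).symm

theorem intervalIntegrable_concat (hT : 0 ≤ T) (hTt : T ≤ t)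
    (hf : IntervalIntegrable f volume 0 T) (hg : IntervalIntegrable g volume 0 (t - T)) :
    IntervalIntegrable (concat T f g) volume 0 t :=
  (intervalIntegrable_concat_left hT le_rfl hf).trans (intervalIntegrable_concat_right hTt hg)

variable [NormedSpace ℝ E]

theorem integral_concat_of_le (ht : 0 ≤ t) (htT : t ≤ T) :
    ∫ s in (0 : ℝ)..t, concat T f g s = ∫ s in (0 : ℝ)..t, f s :=
  intervalIntegral.integral_congr fun _ hs => concat_of_le ((Set.uIcc_of_le ht ▸ hs).2.trans htT)

theorem integral_concat_of_ge (hT : 0 ≤ T) (hTt : T ≤ t)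
    (hf : IntervalIntegrable f volume 0 T) (hg : IntervalIntegrable g volume 0 (t - T)) :
    ∫ s in (0 : ℝ)..t, concat T f g s =
      (∫ s in (0 : ℝ)..T, f s) + ∫ s in (0 : ℝ)..(t - T), g s := by
  have hright : ∫ s in T..t, concat T f g s = ∫ s in T..t, g (s - T) :=
    intervalIntegral.integral_congr_ae (Filter.Eventually.of_forall fun _ hs =>
      concat_of_lt (Set.uIoc_of_le hTt ▸ hs).1)
  rw [← intervalIntegral.integral_add_adjacent_intervals
    (intervalIntegrable_concat_left hT le_rfl hf) (intervalIntegrable_concat_right hTt hg),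
    integral_concat_of_le hT le_rfl, hright, intervalIntegral.integral_comp_sub_right, sub_self]

end Concatenation

section Propagator

open NormedSpace

variable {n : Type*} [Fintype n] [DecidableEq n]

open scoped Matrix.Norms.L2Operator in
theorem hasDerivAt_exp_smul_apply (A : Matrix n n ℂ) (t : ℝ) (i j : n) :
    HasDerivAt (fun s : ℝ => (exp (s • A)) i j) ((A * exp (t • A)) i j) t :=
  (Matrix.entryLinearMap ℝ ℂ i j).toContinuousLinearMap.hasFDerivAt.comp_hasDerivAt t
    (hasDerivAt_exp_smul_const' A t)

theorem continuous_exp_smul (A : Matrix n n ℂ) : Continuous fun s : ℝ => exp (s • A) :=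
  continuous_matrix fun i j => continuous_iff_continuousAt.2 fun t =>
    (hasDerivAt_exp_smul_apply A t i j).continuousAt

theorem isPropagator_const (H : Matrix n n ℂ) (T : ℝ) :
    IsPropagator (fun _ => H) T fun s => exp (s • -(Complex.I • H)) where
  integrable i j := intervalIntegrable_const
  continuousOn := (continuous_exp_smul _).continuousOn
  eq t _ i j := by
    have hderiv (s : ℝ) : HasDerivAt (fun s : ℝ => (exp (s • -(Complex.I • H))) i j)
        (-Complex.I * (H * exp (s • -(Complex.I • H))) i j) s := by
      refine (hasDerivAt_exp_smul_apply _ s i j).congr_deriv ?_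
      rw [← neg_smul, smul_mul_assoc, Matrix.smul_apply, smul_eq_mul]
    have hcont : Continuous fun s : ℝ => -Complex.I * (H * exp (s • -(Complex.I • H))) i j :=
      continuous_const.mul ((continuous_const.mul (continuous_exp_smul _)).matrix_elem i j)
    have hint := intervalIntegral.integral_eq_sub_of_hasDerivAt (fun s _ => hderiv s)
      (hcont.intervalIntegrable 0 t)
    rw [intervalIntegral.integral_const_mul, zero_smul, exp_zero] at hint
    linear_combination -hint

namespace IsPropagator

variable {H U : ℝ → Matrix n n ℂ} {T t : ℝ}

theorem apply_zero (h : IsPropagator H T U) (hT : 0 ≤ T) : U 0 = 1 := by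
  ext i j
  simpa using h.eq 0 ⟨le_rfl, hT⟩ i j

theorem intervalIntegrable_mul_mul (h : IsPropagator H T U) (ht : t ∈ Set.Icc 0 T)
    (V : Matrix n n ℂ) (i j : n) :
    IntervalIntegrable (fun s => (H s * (U s * V)) i j) MeasureTheory.volume 0 t := by
  have hsub : Set.uIcc 0 t ⊆ Set.Icc 0 T := by
    rw [Set.uIcc_of_le ht.1]
    exact Set.Icc_subset_Icc_right ht.2
  have hterm : ∀ k ∈ Finset.univ, IntervalIntegrable (fun s => H s i k * (U s * V) k j)
      MeasureTheory.volume 0 t := by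
    refine fun k _ => IntervalIntegrable.mul_continuousOn ((h.integrable i k).mono_set ?_) ?_
    · rwa [Set.uIcc_of_le (ht.1.trans ht.2)]
    · exact (continuous_id.matrix_elem k j).comp_continuousOn
        ((h.continuousOn.mono hsub).mul continuousOn_const)
  simpa [Finset.sum_fn, Matrix.mul_apply (M := H _)] using IntervalIntegrable.sum _ hterm

theorem mul_apply_eq (h : IsPropagator H T U) (ht : t ∈ Set.Icc 0 T) (V : Matrix n n ℂ) (i j : n) :
    (U t * V) i j = V i j - Complex.I * ∫ s in (0 : ℝ)..t, (H s * (U s * V)) i j := by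
  have hint : ∫ s in (0 : ℝ)..t, (H s * (U s * V)) i j =
      ∑ k, (∫ s in (0 : ℝ)..t, (H s * U s) i k) * V k j := by
    simp only [← mul_assoc, Matrix.mul_apply (N := V), ← intervalIntegral.integral_mul_const]
    refine intervalIntegral.integral_finsetSum fun k _ => IntervalIntegrable.mul_const ?_ _
    simpa using h.intervalIntegrable_mul_mul ht 1 i k
  rw [hint, Matrix.mul_apply]
  simp only [h.eq t ht i, sub_mul, Finset.sum_sub_distrib, mul_assoc]
  rw [← Matrix.mul_apply, one_mul, ← Finset.mul_sum]

theorem concat {H' U' : ℝ → Matrix n n ℂ} {T' : ℝ} (h : IsPropagator H T U)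
    (h' : IsPropagator H' T' U') (hT : 0 ≤ T) (hT' : 0 ≤ T') :
    IsPropagator (concat T H H') (T + T') (concat T U fun s => U' s * U T) where
  integrable i j := by
    rw [concat_map (fun A : Matrix n n ℂ => A i j)]
    refine intervalIntegrable_concat hT (le_add_of_nonneg_right hT') (h.integrable i j) ?_
    rw [add_sub_cancel_left]
    exact h'.integrable i j
  continuousOn := continuousOn_concat hT hT' h.continuousOn
    (h'.continuousOn.mul continuousOn_const) (by rw [h'.apply_zero hT', one_mul])
  eq t ht i j := by
    rw [concat_map₂ fun A B : Matrix n n ℂ => (A * B) i j]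
    rcases le_total t T with htT | hTt
    · rw [concat_of_le htT, integral_concat_of_le ht.1 htT]
      exact h.eq t ⟨ht.1, htT⟩ i j
    · have ht' : t - T ∈ Set.Icc 0 T' := ⟨sub_nonneg.2 hTt, sub_le_iff_le_add'.2 ht.2⟩
      have hint : IntervalIntegrable (fun s => (H s * U s) i j) MeasureTheory.volume 0 T := by
        simpa using h.intervalIntegrable_mul_mul ⟨hT, le_rfl⟩ 1 i j
      rw [concat_of_ge (by rw [h'.apply_zero hT', one_mul]) hTt,
        integral_concat_of_ge hT hTt hint (h'.intervalIntegrable_mul_mul ht' _ i j),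
        h'.mul_apply_eq ht', h.eq T ⟨hT, le_rfl⟩]
      ring

end IsPropagator

end Propagator

section RealDrive

open NormedSpace

variable {χ Δ₀ : ℝ} {r : ℕ}

/-- `V` is the propagator at time `T` of the projected drive Hamiltonian, for some bounded
measurable real `α(t)`. Unlike in `RealizedByRealDrive`, the time is fixed and may be zero. -/
def ReachedAt (χ Δ₀ : ℝ) (r : ℕ) (T : ℝ) (V : Matrix (Fin (r + 1)) (Fin (r + 1)) ℂ) : Prop :=
  ∃ α : ℝ → ℂ, Measurable α ∧ (∃ C : ℝ, ∀ t, ‖α t‖ ≤ C) ∧ (∀ t, (α t).im = 0) ∧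
    ∃ U : ℝ → Matrix (Fin (r + 1)) (Fin (r + 1)) ℂ,
      IsPropagator (fun t => blockade r (driveHamiltonian χ Δ₀ r (α t))) T U ∧ U T = V

/-- The element of the Lie algebra `𝔲(r + 1)` generating the evolution under the drift and the
constant amplitude `v` of the control `H_{c,R}`. -/
def driveGenerator (χ Δ₀ : ℝ) (r : ℕ) (v : ℝ) : Matrix (Fin (r + 1)) (Fin (r + 1)) ℂ :=
  -(Complex.I • (drift χ Δ₀ r + v • controlRe r))

theorem driveGenerator_eq (v : ℝ) : driveGenerator χ Δ₀ r v =
    -(Complex.I • drift χ Δ₀ r + v • Complex.I • controlRe r) := by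
  rw [driveGenerator, smul_add, smul_comm]

theorem reachedAt_exp_smul (hχ : χ ≠ 0) (v t : ℝ) :
    ReachedAt χ Δ₀ r t (exp (t • driveGenerator χ Δ₀ r v)) := by
  refine ⟨fun _ => ((v / χ : ℝ) : ℂ), measurable_const, ⟨_, fun _ => le_rfl⟩,
    fun _ => Complex.ofReal_im _, _, isPropagator_const _ t, ?_⟩
  rw [blockade_driveHamiltonian, Complex.ofReal_re, Complex.ofReal_im, mul_div_cancel₀ _ hχ,
    mul_zero, Complex.ofReal_zero, zero_smul, add_zero, Complex.coe_smul, driveGenerator]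

theorem ReachedAt.mul {T T' : ℝ} {V V' : Matrix (Fin (r + 1)) (Fin (r + 1)) ℂ}
    (hV' : ReachedAt χ Δ₀ r T' V') (hV : ReachedAt χ Δ₀ r T V) (hT : 0 ≤ T) (hT' : 0 ≤ T') :
    ReachedAt χ Δ₀ r (T + T') (V' * V) := by
  obtain ⟨α, hα, ⟨C, hC⟩, hreal, U, hU, rfl⟩ := hV
  obtain ⟨α', hα', ⟨C', hC'⟩, hreal', U', hU', rfl⟩ := hV'
  refine ⟨concat T α α', measurable_concat hα hα', ⟨max C C', fun t => ?_⟩, fun t => ?_,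
    concat T U fun s => U' s * U T, ?_, ?_⟩
  · rcases le_or_gt t T with h | h
    · rw [concat_of_le h]
      exact (hC t).trans (le_max_left _ _)
    · rw [concat_of_lt h]
      exact (hC' _).trans (le_max_right _ _)
  · rcases le_or_gt t T with h | h
    · rw [concat_of_le h, hreal]
    · rw [concat_of_lt h, hreal']
  · rw [concat_map fun a => blockade r (driveHamiltonian χ Δ₀ r a)]
    exact hU.concat hU' hT hT'
  · rw [concat_of_ge (by rw [hU'.apply_zero hT', one_mul]) (le_add_of_nonneg_right hT'),
      add_sub_cancel_left]

/-- The matrices reached by the projected drive Hamiltonian, with a real `α(t)`, in some time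
`T ≥ 0`. -/
def reachable (χ Δ₀ : ℝ) (r : ℕ) : Submonoid (Matrix (Fin (r + 1)) (Fin (r + 1)) ℂ) where
  carrier := {V | ∃ T : ℝ, 0 ≤ T ∧ ReachedAt χ Δ₀ r T V}
  one_mem' := ⟨0, le_rfl, fun _ => 0, measurable_const, ⟨0, fun _ => norm_zero.le⟩,
    fun _ => Complex.zero_im, _, isPropagator_const _ 0, by rw [zero_smul, exp_zero]⟩
  mul_mem' := by
    rintro V' V ⟨T', hT', hV'⟩ ⟨T, hT, hV⟩
    exact ⟨T + T', add_nonneg hT hT', hV'.mul hV hT hT'⟩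

theorem flowSemigroup_le_reachable (hχ : χ ≠ 0) :
    flowSemigroup (Set.range (driveGenerator χ Δ₀ r)) ≤ reachable χ Δ₀ r := by
  refine flowSemigroup_le ?_
  rintro _ ⟨v, rfl⟩ t ht
  exact ⟨t, ht, reachedAt_exp_smul hχ v t⟩

theorem range_driveGenerator_subset_skewAdjoint : Set.range (driveGenerator χ Δ₀ r) ⊆
    skewAdjoint (Matrix (Fin (r + 1)) (Fin (r + 1)) ℂ) := by
  rintro _ ⟨v, rfl⟩
  rw [driveGenerator_eq]
  exact neg_mem (add_mem (I_smul_drift_mem_skewAdjoint χ Δ₀)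
    (skewAdjoint.smul_mem v I_smul_controlRe_mem_specialUnitaryLie.1))

theorem specialUnitaryLie_le_lieSpan_driveGenerator (hχ : χ ≠ 0)
    (hr : (r : ℝ) ≠ 1 - 2 * Δ₀ / χ) : specialUnitaryLie (Fin (r + 1)) ≤
      LieSubalgebra.lieSpan ℝ _ (Set.range (driveGenerator χ Δ₀ r)) := by
  set L := LieSubalgebra.lieSpan ℝ (Matrix (Fin (r + 1)) (Fin (r + 1)) ℂ)
    (Set.range (driveGenerator χ Δ₀ r))
  have hmem (v : ℝ) : Complex.I • drift χ Δ₀ r + v • Complex.I • controlRe r ∈ L := by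
    rw [← neg_mem_iff, ← driveGenerator_eq]
    exact LieSubalgebra.subset_lieSpan ⟨v, rfl⟩
  have hdrift : Complex.I • drift χ Δ₀ r ∈ L := by simpa using hmem 0
  have hcontrol : Complex.I • controlRe r ∈ L := by simpa using sub_mem (hmem 1) hdrift
  exact specialUnitaryLie_le_of_drift_mem hχ hr hdrift hcontrol

theorem specialUnitaryGroup_le_reachable (hχ : χ ≠ 0) (hr : (r : ℝ) ≠ 1 - 2 * Δ₀ / χ) :
    Matrix.specialUnitaryGroup (Fin (r + 1)) ℂ ≤ reachable χ Δ₀ r :=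
  (specialUnitaryGroup_le_flowSemigroup range_driveGenerator_subset_skewAdjoint
    (specialUnitaryLie_le_lieSpan_driveGenerator hχ hr)).trans (flowSemigroup_le_reachable hχ)

theorem unitaryGroup_le_reachable (hχ : χ ≠ 0) (hr : (r : ℝ) ≠ 1 - 2 * Δ₀ / χ)
    (htrace : (drift χ Δ₀ r).trace ≠ 0) :
    Matrix.unitaryGroup (Fin (r + 1)) ℂ ≤ reachable χ Δ₀ r := by
  have hgen : driveGenerator χ Δ₀ r 0 = -(Complex.I • drift χ Δ₀ r) := by
    rw [driveGenerator, zero_smul, add_zero]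
  have htrace' : (driveGenerator χ Δ₀ r 0).trace ≠ 0 := by
    rw [hgen, Matrix.trace_neg, Matrix.trace_smul]
    exact neg_ne_zero.2 (smul_ne_zero Complex.I_ne_zero htrace)
  have hskew := range_driveGenerator_subset_skewAdjoint (χ := χ) (Δ₀ := Δ₀) (r := r)
  exact (unitaryGroup_le_flowSemigroup hskew (skewAdjointLie_le_of_specialUnitaryLie_le
    (specialUnitaryLie_le_lieSpan_driveGenerator hχ hr)
    (LieSubalgebra.subset_lieSpan ⟨0, rfl⟩) (hskew ⟨0, rfl⟩) htrace')).trans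
    (flowSemigroup_le_reachable hχ)

variable {V : Matrix (Fin (r + 1)) (Fin (r + 1)) ℂ}

/-- Letting the drift act alone for one unit of time before reaching `V * exp (i H_d)` makes the
total time positive. -/
theorem realizedByRealDrive_of_mul_exp_mem_reachable (hχ : χ ≠ 0)
    (hV : V * exp (Complex.I • drift χ Δ₀ r) ∈ reachable χ Δ₀ r) :
    RealizedByRealDrive χ Δ₀ r V := by
  obtain ⟨T, hT, h⟩ := hV
  have hcancel : exp (Complex.I • drift χ Δ₀ r) * exp ((1 : ℝ) • driveGenerator χ Δ₀ r 0) = 1 := by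
    rw [one_smul, driveGenerator, zero_smul, add_zero, ← Matrix.exp_add_of_commute _ _
      (Commute.neg_right (Commute.refl (Complex.I • drift χ Δ₀ r))), add_neg_cancel, exp_zero]
  have hreach := h.mul (reachedAt_exp_smul hχ 0 1) zero_le_one hT
  rw [mul_assoc, hcancel, mul_one] at hreach
  exact ⟨1 + T, add_pos_of_pos_of_nonneg one_pos hT, hreach⟩

theorem realizedByRealDrive_of_mem_unitaryGroup (hχ : χ ≠ 0) (hr : (r : ℝ) ≠ 1 - 2 * Δ₀ / χ)
    (htrace : (drift χ Δ₀ r).trace ≠ 0) (hV : V ∈ Matrix.unitaryGroup (Fin (r + 1)) ℂ) :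
    RealizedByRealDrive χ Δ₀ r V :=
  realizedByRealDrive_of_mul_exp_mem_reachable hχ (unitaryGroup_le_reachable hχ hr htrace
    (mul_mem hV (exp_mem_unitaryGroup (I_smul_drift_mem_skewAdjoint χ Δ₀))))

theorem realizedByRealDrive_of_mem_specialUnitaryGroup (hχ : χ ≠ 0)
    (hr : (r : ℝ) ≠ 1 - 2 * Δ₀ / χ) (hV : V ∈ Matrix.specialUnitaryGroup (Fin (r + 1)) ℂ) :
    RealizedByRealDrive χ Δ₀ r V := by
  by_cases htrace : (drift χ Δ₀ r).trace = 0
  · have hdrift : Complex.I • drift χ Δ₀ r ∈ specialUnitaryLie (Fin (r + 1)) :=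
      mem_specialUnitaryLie.2 ⟨I_smul_drift_mem_skewAdjoint χ Δ₀, by
        rw [Matrix.trace_smul, htrace, smul_zero]⟩
    exact realizedByRealDrive_of_mul_exp_mem_reachable hχ (specialUnitaryGroup_le_reachable hχ hr
      (mul_mem hV (exp_mem_specialUnitaryGroup hdrift)))
  · exact realizedByRealDrive_of_mem_unitaryGroup hχ hr htrace
      (Matrix.specialUnitaryGroup_le_unitaryGroup hV)

end RealDrive

theorem specialUnitaryLie_le_dynamicalLieAlgebra {χ Δ₀ : ℝ} {r : ℕ} {ι : Type*}
    {Hc : ι → Matrix (Fin (r + 1)) (Fin (r + 1)) ℂ} (hχ : χ ≠ 0) (hr : (r : ℝ) ≠ 1 - 2 * Δ₀ / χ)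
    {j : ι} (hj : Hc j = controlRe r) :
    specialUnitaryLie (Fin (r + 1)) ≤ dynamicalLieAlgebra (drift χ Δ₀ r) Hc :=
  specialUnitaryLie_le_of_drift_mem hχ hr I_smul_drift_mem_dynamicalLieAlgebra
    (hj ▸ I_smul_control_mem_dynamicalLieAlgebra j)

end KerrControl

end

theorem mainTheorem1 (χ Δ₀ : ℝ) (r : ℕ) (hχ : χ ≠ 0) (hr : (r : ℝ) ≠ 1 - 2 * Δ₀ / χ) :
    -- the projected drive Hamiltonian is a control system with this drift and these two controls
    (∀ α : ℂ, KerrControl.blockade r (KerrControl.driveHamiltonian χ Δ₀ r α) =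
      KerrControl.drift χ Δ₀ r + ((χ * α.re : ℝ) : ℂ) • KerrControl.controlRe r
        + ((χ * α.im : ℝ) : ℂ) • KerrControl.controlIm r) ∧
    -- dynamical Lie group when `Im α(t) = 0`, i.e. with the single control `H_{c,R}`
    (Matrix.specialUnitaryGroup (Fin (r + 1)) ℂ ≤
      KerrControl.dynamicalLieGroup (KerrControl.drift χ Δ₀ r) ![KerrControl.controlRe r]) ∧
    ((KerrControl.drift χ Δ₀ r).trace ≠ 0 →
      KerrControl.dynamicalLieGroup (KerrControl.drift χ Δ₀ r) ![KerrControl.controlRe r] =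
        Matrix.unitaryGroup (Fin (r + 1)) ℂ) ∧
    -- dynamical Lie group with both controls
    (Matrix.specialUnitaryGroup (Fin (r + 1)) ℂ ≤
      KerrControl.dynamicalLieGroup (KerrControl.drift χ Δ₀ r)
        ![KerrControl.controlRe r, KerrControl.controlIm r]) ∧
    ((KerrControl.drift χ Δ₀ r).trace ≠ 0 →
      KerrControl.dynamicalLieGroup (KerrControl.drift χ Δ₀ r)
          ![KerrControl.controlRe r, KerrControl.controlIm r] =
        Matrix.unitaryGroup (Fin (r + 1)) ℂ) ∧
    -- universal control, even with `Im α(t) = 0`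
    (∀ V ∈ Matrix.specialUnitaryGroup (Fin (r + 1)) ℂ,
      KerrControl.RealizedByRealDrive χ Δ₀ r V) ∧
    ((KerrControl.drift χ Δ₀ r).trace ≠ 0 →
      ∀ V ∈ Matrix.unitaryGroup (Fin (r + 1)) ℂ, KerrControl.RealizedByRealDrive χ Δ₀ r V) := by
  have hsu₁ := KerrControl.specialUnitaryLie_le_dynamicalLieAlgebra hχ hr
    (Hc := ![KerrControl.controlRe r]) (j := 0) rfl
  have hsu₂ := KerrControl.specialUnitaryLie_le_dynamicalLieAlgebra hχ hr
    (Hc := ![KerrControl.controlRe r, KerrControl.controlIm r]) (j := 0) rfl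
  have hdrift := KerrControl.I_smul_drift_mem_skewAdjoint (r := r) χ Δ₀
  have hRe := (KerrControl.I_smul_controlRe_mem_specialUnitaryLie (r := r)).1
  have hIm := (KerrControl.I_smul_controlIm_mem_specialUnitaryLie (r := r)).1
  exact ⟨KerrControl.blockade_driveHamiltonian χ Δ₀ r,
    KerrControl.specialUnitaryGroup_le_dynamicalLieGroup hsu₁,
    fun htrace => KerrControl.dynamicalLieGroup_eq_unitaryGroup htrace hdrift
      (Fin.forall_fin_one.2 hRe) hsu₁,
    KerrControl.specialUnitaryGroup_le_dynamicalLieGroup hsu₂,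
    fun htrace => KerrControl.dynamicalLieGroup_eq_unitaryGroup htrace hdrift
      (Fin.forall_fin_two.2 ⟨hRe, hIm⟩) hsu₂,
    fun _ hV => KerrControl.realizedByRealDrive_of_mem_specialUnitaryGroup hχ hr hV,
    fun htrace _ hV => KerrControl.realizedByRealDrive_of_mem_unitaryGroup hχ hr htrace hV⟩
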